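/- For $f\in L^2(\mathbb R)=L^2(\mathbb R;\mathbb C)$ let $\widehat f(\xi)=\int_{\mathbb R}e^{-ix\xi}f(x)\,dx$ be its Fourier transform (extended to $L^2$ by Plancherel), and let $\langle g,f\rangle=\int_{\mathbb R}\overline{g}\,f\,dx$. For $f_1,\dots,f_6\in L^2(\mathbb R)$ put $$Q(f_1,\dots,f_6)=\int_{\mathbb R^6}\overline{\widehat{f_1}}(\xi_1)\,\overline{\widehat{f_2}}(\xi_2)\,\overline{\widehat{f_3}}(\xi_3)\,\widehat{f_4}(\xi_4)\,\widehat{f_5}(\xi_5)\,\widehat{f_6}(\xi_6)\;\delta(\xi_1+\xi_2+\xi_3-\xi_4-\xi_5-\xi_6)\,\delta(\xi_1^2+\xi_2^2+\xi_3^2-\xi_4^2-\xi_5^2-\xi_6^2)\,d\xi_1\cdots d\xi_6,$$ where $\delta$ is the Dirac delta, and the product of the two deltas is the positive measure on $\mathbb R^6$ obtained as the limit when each of them is replaced by the approximate identity $\frac1{2\varepsilon}1_{(-\varepsilon,\varepsilon)}$. **Theorem.** Let $\omega>0$, and let $f\in L^2(\mathbb R)$ solve the generalized Euler–Lagrange equation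 $$\omega\langle g,f\rangle=Q(g,f,f,f,f,f)\qquad\text{for all } g\in L^2(\mathbb R).$$ Then there exists $\mu>0$ such that $e^{\mu|\xi|^2}\widehat f\in L^2(\mathbb R)$. Furthermore, $f$ extends to a complex analytic function on $\mathbb C$: there is an entire function $F$ with $F(x)=f(x)$ for almost every $x\in\mathbb R$. -/

import Mathlib

open MeasureTheory Set Filter Topology
open scoped FourierTransform ComplexConjugate

namespace Strichartz

noncomputable section

/-- Euclidean space `ℝ³`, used only as a measurable and topological space. The space `ℝ⁶` of the
variables `(ξ₁, …, ξ₆)` is written as `R3 × R3`, the point `(ξ₁, …, ξ₆)` being `(v, w)` with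
`v = (ξ₁, ξ₂, ξ₃)` and `w = (ξ₄, ξ₅, ξ₆)`. -/
abbrev R3 : Type := Fin 3 → ℝ

/-- `ξ₁ + ξ₂ + ξ₃ - ξ₄ - ξ₅ - ξ₆`. -/
def linDefect (p : R3 × R3) : ℝ :=
  p.1 0 + p.1 1 + p.1 2 - p.2 0 - p.2 1 - p.2 2

/-- `ξ₁² + ξ₂² + ξ₃² - ξ₄² - ξ₅² - ξ₆²`. -/
def quadDefect (p : R3 × R3) : ℝ :=
  p.1 0 ^ 2 + p.1 1 ^ 2 + p.1 2 ^ 2 - p.2 0 ^ 2 - p.2 1 ^ 2 - p.2 2 ^ 2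

/-- The rotation of `ℝ³` by the angle `θ` about the axis `(1, 1, 1)`. -/
def rot (θ : ℝ) (v : R3) : R3 := fun i =>
  (v 0 + v 1 + v 2) / 3 + Real.cos θ * (v i - (v 0 + v 1 + v 2) / 3) +
    Real.sin θ / Real.sqrt 3 * (v (i + 2) - v (i + 1))

/-- The measure `δ(ξ₁+ξ₂+ξ₃-ξ₄-ξ₅-ξ₆) δ(ξ₁²+ξ₂²+ξ₃²-ξ₄²-ξ₅²-ξ₆²) dξ₁⋯dξ₆` on `ℝ⁶`. For a fixed
`v = (ξ₁, ξ₂, ξ₃)` the two constraints on `w = (ξ₄, ξ₅, ξ₆)` describe the circle through `v` about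
the axis `(1, 1, 1)`, and the two delta functions give it the uniform measure `dθ / (2√3)`.
That this measure is the product of the two delta functions is proved in
`tendsto_integral_deltaMeasure`. -/
def deltaMeasure : Measure (R3 × R3) :=
  ENNReal.ofReal (1 / (2 * Real.sqrt 3)) •
    Measure.map (fun q : R3 × ℝ => (q.1, rot q.2 q.1))
      ((volume : Measure R3).prod ((volume : Measure ℝ).restrict (Ioc 0 (2 * Real.pi))))

/-- `L²(ℝ)`, with complex values. -/
abbrev L2 : Type := Lp ℂ 2 (volume : Measure ℝ)

/-- The Fourier transform on `L²(ℝ)` normalized as `f̂(ξ) = ∫ e^{-ixξ} f(x) dx`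
(Mathlib's `𝓕 f` is normalized as `∫ e^{-2πixξ} f(x) dx`). -/
def hat (f : L2) : ℝ → ℂ := fun ξ => (𝓕 f : L2) (ξ / (2 * Real.pi))

/-- The form `Q(f₁, …, f₆)`: the integral of the product of
`conj f̂₁(ξ₁)`, `conj f̂₂(ξ₂)`, `conj f̂₃(ξ₃)`, `f̂₄(ξ₄)`, `f̂₅(ξ₅)`, `f̂₆(ξ₆)` against
`δ(ξ₁+ξ₂+ξ₃-ξ₄-ξ₅-ξ₆) δ(ξ₁²+ξ₂²+ξ₃²-ξ₄²-ξ₅²-ξ₆²) dξ`. -/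
def Q (f₁ f₂ f₃ f₄ f₅ f₆ : L2) : ℂ :=
  ∫ p : R3 × R3, conj (hat f₁ (p.1 0)) * conj (hat f₂ (p.1 1)) * conj (hat f₃ (p.1 2)) *
    hat f₄ (p.2 0) * hat f₅ (p.2 1) * hat f₆ (p.2 2) ∂deltaMeasure

/-- `f` solves the generalized Euler-Lagrange equation `ω ⟨g, f⟩ = Q(g, f, f, f, f, f)` for all
`g ∈ L²(ℝ)`, where `⟨g, f⟩ = ∫ conj g · f`. -/
def SolvesEulerLagrange (ω : ℝ) (f : L2) : Prop :=
  ∀ g : L2, (ω : ℂ) * inner ℂ g f = Q g f f f f f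

/-! ### The measure is the product of the two delta functions -/

/-- The approximate identity `1_{|x| < ε} / (2ε)`. -/
def deltaApprox (ε x : ℝ) : ℝ := if |x| < ε then 1 / (2 * ε) else 0

/-- The point of the circle `w₁ + w₂ + w₃ = σ`, `w₁² + w₂² + w₃² = τ` at the angle `α`. -/
def circ (q : ℝ × (ℝ × ℝ)) : R3 :=
  ![q.2.1 / 3 + Real.sqrt (q.2.2 - q.2.1 ^ 2 / 3) *
      (Real.cos q.1 * (1 / Real.sqrt 2) + Real.sin q.1 * (1 / Real.sqrt 6)),
    q.2.1 / 3 + Real.sqrt (q.2.2 - q.2.1 ^ 2 / 3) *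
      (Real.cos q.1 * (-1 / Real.sqrt 2) + Real.sin q.1 * (1 / Real.sqrt 6)),
    q.2.1 / 3 + Real.sqrt (q.2.2 - q.2.1 ^ 2 / 3) *
      (Real.sin q.1 * (-2 / Real.sqrt 6))]

def cartMatrix : Matrix (Fin 3) (Fin 3) ℝ :=
  !![1 / 3, 1 / Real.sqrt 2, 1 / Real.sqrt 6;
     1 / 3, -1 / Real.sqrt 2, 1 / Real.sqrt 6;
     1 / 3, 0, -2 / Real.sqrt 6]

lemma sqrt_six : Real.sqrt 6 = Real.sqrt 2 * Real.sqrt 3 := by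
  rw [← Real.sqrt_mul (by norm_num)]; norm_num

lemma cartMatrix_det : cartMatrix.det = 1 / Real.sqrt 3 := by
  have h2 : Real.sqrt 2 ^ 2 = 2 := Real.sq_sqrt (by norm_num)
  have p2 : Real.sqrt 2 ≠ 0 := by positivity
  have p3 : Real.sqrt 3 ≠ 0 := by positivity
  rw [cartMatrix, Matrix.det_fin_three]
  simp only [Matrix.of_apply, Matrix.cons_val', Matrix.cons_val_zero, Matrix.cons_val_one,
    Matrix.cons_val, sqrt_six]
  field_simp
  nlinarith

lemma continuous_circ : Continuous circ := by
  unfold circ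
  refine continuous_pi fun i => ?_
  fin_cases i <;> simp <;> fun_prop

lemma circ_sum (α σ τ : ℝ) : circ (α, σ, τ) 0 + circ (α, σ, τ) 1 + circ (α, σ, τ) 2 = σ := by
  simp [circ]; ring

lemma circ_sq (α σ τ : ℝ) (h : σ ^ 2 / 3 ≤ τ) :
    circ (α, σ, τ) 0 ^ 2 + circ (α, σ, τ) 1 ^ 2 + circ (α, σ, τ) 2 ^ 2 = τ := by
  have h2 : Real.sqrt 2 ^ 2 = 2 := Real.sq_sqrt (by norm_num)
  have h3 : Real.sqrt 3 ^ 2 = 3 := Real.sq_sqrt (by norm_num)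
  have p2 : Real.sqrt 2 ≠ 0 := by positivity
  have p3 : Real.sqrt 3 ≠ 0 := by positivity
  have hr : Real.sqrt (τ - σ ^ 2 / 3) ^ 2 = τ - σ ^ 2 / 3 := Real.sq_sqrt (by linarith)
  have hc := Real.sin_sq_add_cos_sq α
  have i2 : (1 / Real.sqrt 2) ^ 2 = 1 / 2 := by rw [div_pow, h2]; norm_num
  have i6 : (1 / Real.sqrt 6) ^ 2 = 1 / 6 := by
    rw [div_pow, Real.sq_sqrt (by norm_num)]; norm_num
  have e1 : -1 / Real.sqrt 2 = -(1 / Real.sqrt 2) := by ring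
  have e2 : -2 / Real.sqrt 6 = -2 * (1 / Real.sqrt 6) := by ring
  simp only [circ, Matrix.cons_val_zero, Matrix.cons_val_one, Matrix.cons_val, e1, e2]
  generalize 1 / Real.sqrt 2 = x at *
  generalize 1 / Real.sqrt 6 = y at *
  generalize Real.sqrt (τ - σ ^ 2 / 3) = r at *
  generalize Real.sin α = s at *
  generalize Real.cos α = c at *
  have : c ^ 2 = 1 - s ^ 2 := by linarith
  ring_nf
  simp only [i2, i6, hr, this]
  ring

/-- Lebesgue measure on `ℝ³` in the coordinates angle, sum, sum of squares. -/
lemma volume_eq_map_circ : (volume : Measure R3) = ENNReal.ofReal (1 / (2 * Real.sqrt 3)) •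
    Measure.map circ (((volume : Measure ℝ).restrict (Ioo (-Real.pi) Real.pi)).prod
      ((volume : Measure (ℝ × ℝ)).restrict {x | x.1 ^ 2 / 3 < x.2})) := by
  have p3 : (0 : ℝ) < Real.sqrt 3 := by positivity
  have hD : MeasurableSet {x : ℝ × ℝ | x.1 ^ 2 / 3 < x.2} :=
    measurableSet_lt (by fun_prop) (by fun_prop)
  refine Measure.ext_of_lintegral _ fun g hg => ?_
  -- linear change of variables
  have h1 : ∫⁻ v : R3, g v = ENNReal.ofReal (1 / Real.sqrt 3) *
      ∫⁻ w : R3, g (cartMatrix.toLin' w) := by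
    have hdet : cartMatrix.det ≠ 0 := by rw [cartMatrix_det]; positivity
    have hm : Measurable (cartMatrix.toLin') :=
      (LinearMap.continuous_of_finiteDimensional _).measurable
    rw [← lintegral_map hg hm, Real.map_matrix_volume_pi_eq_smul_volume_pi hdet, cartMatrix_det,
      lintegral_smul_measure, smul_eq_mul, ← mul_assoc, ← ENNReal.ofReal_mul (by positivity)]
    rw [abs_of_pos (by positivity), mul_inv_cancel₀ (by positivity)]
    simp
  have h2 : ∀ h : R3 → ENNReal, Measurable h →
      ∫⁻ w : R3, h w = ∫⁻ σ : ℝ, ∫⁻ x : ℝ × ℝ, h ![σ, x.1, x.2] := by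
    intro h hh
    have a := (volume_preserving_piFinSuccAbove (fun _ : Fin 3 => ℝ) 0)
    have b := (volume_preserving_finTwoArrow ℝ)
    have hp : Measurable fun y : ℝ × (Fin 2 → ℝ) =>
        h ((MeasurableEquiv.piFinSuccAbove (fun _ : Fin 3 => ℝ) 0).symm y) :=
      hh.comp (MeasurableEquiv.measurable _)
    rw [← a.symm.lintegral_comp hh, Measure.volume_eq_prod, lintegral_prod _ hp.aemeasurable]
    refine lintegral_congr fun σ => ?_
    have hq : Measurable fun y : Fin 2 → ℝ =>
        h ((MeasurableEquiv.piFinSuccAbove (fun _ : Fin 3 => ℝ) 0).symm (σ, y)) :=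
      hp.comp (by fun_prop)
    rw [← b.symm.lintegral_comp hq]
    refine lintegral_congr fun x => ?_
    congr 1
    ext i
    fin_cases i <;> rfl
  have h3 : ∀ (σ : ℝ) (k : ℝ × ℝ → ENNReal), Measurable k → ∫⁻ x : ℝ × ℝ, k x =
      ENNReal.ofReal (1 / 2) * ∫⁻ τ in Ioi (σ ^ 2 / 3), ∫⁻ α in Ioo (-Real.pi) Real.pi,
        k (Real.sqrt (τ - σ ^ 2 / 3) * Real.cos α, Real.sqrt (τ - σ ^ 2 / 3) * Real.sin α) := by
    intro σ k hk
    have him : (fun r : ℝ => r ^ 2 + σ ^ 2 / 3) '' Ioi 0 = Ioi (σ ^ 2 / 3) := by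
      ext τ
      simp only [mem_image, mem_Ioi]
      constructor
      · rintro ⟨r, hr, rfl⟩
        have : 0 < r ^ 2 := by positivity
        linarith
      · intro h
        refine ⟨Real.sqrt (τ - σ ^ 2 / 3), Real.sqrt_pos.2 (by linarith), ?_⟩
        rw [Real.sq_sqrt (by linarith)]; ring
    rw [← him, lintegral_image_eq_lintegral_abs_deriv_mul (f' := fun r => 2 * r) measurableSet_Ioi,
      ← lintegral_comp_polarCoord_symm, polarCoord_target, Measure.volume_eq_prod,
      ← Measure.prod_restrict, lintegral_prod, ← lintegral_const_mul']
    · refine setLIntegral_congr_fun measurableSet_Ioi fun r hr => ?_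
      have hr' : (0 : ℝ) < r := hr
      simp only [add_sub_cancel_right, Real.sqrt_sq hr'.le, polarCoord_symm_apply, smul_eq_mul]
      rw [lintegral_const_mul' _ _ ENNReal.ofReal_ne_top, ← mul_assoc,
        ← ENNReal.ofReal_mul (by norm_num), abs_of_pos (by positivity)]
      congr 2
      ring
    · exact ENNReal.ofReal_ne_top
    · refine Measurable.aemeasurable ?_
      simp only [polarCoord_symm_apply, smul_eq_mul]
      fun_prop
    · intro r _
      have := (hasDerivAt_pow 2 r).add_const (σ ^ 2 / 3)
      simpa using this.hasDerivWithinAt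
    · intro r hr r' hr' h
      simp only [mem_Ioi] at hr hr'
      have : r ^ 2 = r' ^ 2 := by simpa using h
      exact (pow_left_inj₀ hr.le hr'.le two_ne_zero).1 this
  have hgm : Measurable fun w : R3 => g (cartMatrix.toLin' w) :=
    hg.comp (LinearMap.continuous_of_finiteDimensional _).measurable
  have hvec : Measurable fun y : ℝ × (ℝ × ℝ) => (![y.1, y.2.1, y.2.2] : R3) := by
    refine measurable_pi_lambda _ fun i => ?_
    fin_cases i <;> simp <;> fun_prop
  have hgc : Measurable fun q => g (circ q) := hg.comp continuous_circ.measurable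
  have h4 : ∀ σ : ℝ, ∫⁻ x : ℝ × ℝ, g (cartMatrix.toLin' ![σ, x.1, x.2]) =
      ENNReal.ofReal (1 / 2) * ∫⁻ τ, {x : ℝ × ℝ | x.1 ^ 2 / 3 < x.2}.indicator
        (fun y => ∫⁻ α in Ioo (-Real.pi) Real.pi, g (circ (α, y))) (σ, τ) := by
    intro σ
    have hk : Measurable fun x : ℝ × ℝ => g (cartMatrix.toLin' ![σ, x.1, x.2]) :=
      hgm.comp (hvec.comp (by fun_prop : Measurable fun x : ℝ × ℝ => (σ, x)))
    rw [h3 σ _ hk, ← lintegral_indicator measurableSet_Ioi]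
    congr 1
    refine lintegral_congr fun τ => ?_
    by_cases h : σ ^ 2 / 3 < τ
    · rw [indicator_of_mem (by exact h), indicator_of_mem (by exact h)]
      refine lintegral_congr fun α => ?_
      congr 1
      ext i
      fin_cases i <;>
        simp [circ, cartMatrix, Matrix.toLin'_apply, Matrix.mulVec, dotProduct,
          Fin.sum_univ_three] <;> ring
    · rw [indicator_of_notMem (by exact h), indicator_of_notMem (by exact h)]
  rw [h1, h2 _ hgm, lintegral_congr h4, lintegral_smul_measure, lintegral_map hg continuous_circ.measurable,
    lintegral_prod_symm' _ hgc, ← lintegral_indicator hD, Measure.volume_eq_prod, lintegral_prod]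
  swap
  · refine (Measurable.indicator ?_ hD).aemeasurable
    exact hgc.lintegral_prod_left'
  rw [lintegral_const_mul' _ _ ENNReal.ofReal_ne_top, ← mul_assoc,
    ← ENNReal.ofReal_mul (by positivity), smul_eq_mul]
  congr 2
  field_simp

/-- A rotation about `(1, 1, 1)` shifts the angle. -/
lemma exists_rot_eq_circ (v : R3) : ∃ α₀ : ℝ, ∀ θ : ℝ,
    rot θ v = circ (θ + α₀, v 0 + v 1 + v 2, v 0 ^ 2 + v 1 ^ 2 + v 2 ^ 2) := by
  have h2 : Real.sqrt 2 ^ 2 = 2 := Real.sq_sqrt (by norm_num)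
  have i2 : (1 / Real.sqrt 2) ^ 2 = 1 / 2 := by rw [div_pow, h2]; norm_num
  have i6 : (1 / Real.sqrt 6) ^ 2 = 1 / 6 := by
    rw [div_pow, Real.sq_sqrt (by norm_num)]; norm_num
  have i3 : 1 / Real.sqrt 3 = 2 * (1 / Real.sqrt 2) * (1 / Real.sqrt 6) := by
    rw [sqrt_six]; field_simp; exact h2
  have e1 : -1 / Real.sqrt 2 = -(1 / Real.sqrt 2) := by ring
  have e2 : -2 / Real.sqrt 6 = -2 * (1 / Real.sqrt 6) := by ring
  set x := 1 / Real.sqrt 2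
  set y := 1 / Real.sqrt 6
  set z : ℂ := ⟨(v 0 - v 1) * x, (v 0 + v 1 - 2 * v 2) * y⟩ with hz
  have hr : Real.sqrt (v 0 ^ 2 + v 1 ^ 2 + v 2 ^ 2 - (v 0 + v 1 + v 2) ^ 2 / 3) = ‖z‖ := by
    rw [Complex.norm_eq_sqrt_sq_add_sq]
    congr 1
    simp only [hz]
    linear_combination -(v 0 - v 1) ^ 2 * i2 - (v 0 + v 1 - 2 * v 2) ^ 2 * i6
  have hc : ‖z‖ * Real.cos z.arg = (v 0 - v 1) * x := Complex.norm_mul_cos_arg z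
  have hs : ‖z‖ * Real.sin z.arg = (v 0 + v 1 - 2 * v 2) * y := Complex.norm_mul_sin_arg z
  refine ⟨z.arg, fun θ => ?_⟩
  have e3 : Real.sin θ / Real.sqrt 3 = Real.sin θ * (2 * x * y) := by rw [← i3]; ring
  ext i
  fin_cases i
  · change (v 0 + v 1 + v 2) / 3 + Real.cos θ * (v 0 - (v 0 + v 1 + v 2) / 3) +
      Real.sin θ / Real.sqrt 3 * (v 2 - v 1) = (v 0 + v 1 + v 2) / 3 +
        Real.sqrt (v 0 ^ 2 + v 1 ^ 2 + v 2 ^ 2 - (v 0 + v 1 + v 2) ^ 2 / 3) *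
          (Real.cos (θ + z.arg) * x + Real.sin (θ + z.arg) * y)
    rw [hr, e3, Real.cos_add, Real.sin_add]
    linear_combination -(Real.cos θ * x + Real.sin θ * y) * hc -
      (Real.cos θ * y - Real.sin θ * x) * hs - Real.cos θ * (v 0 - v 1) * i2 -
      Real.cos θ * (v 0 + v 1 - 2 * v 2) * i6
  · change (v 0 + v 1 + v 2) / 3 + Real.cos θ * (v 1 - (v 0 + v 1 + v 2) / 3) +
      Real.sin θ / Real.sqrt 3 * (v 0 - v 2) = (v 0 + v 1 + v 2) / 3 +
        Real.sqrt (v 0 ^ 2 + v 1 ^ 2 + v 2 ^ 2 - (v 0 + v 1 + v 2) ^ 2 / 3) *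
          (Real.cos (θ + z.arg) * (-1 / Real.sqrt 2) + Real.sin (θ + z.arg) * y)
    rw [hr, e3, e1, Real.cos_add, Real.sin_add]
    linear_combination -(-Real.cos θ * x + Real.sin θ * y) * hc -
      (Real.cos θ * y + Real.sin θ * x) * hs + Real.cos θ * (v 0 - v 1) * i2 -
      Real.cos θ * (v 0 + v 1 - 2 * v 2) * i6
  · change (v 0 + v 1 + v 2) / 3 + Real.cos θ * (v 2 - (v 0 + v 1 + v 2) / 3) +
      Real.sin θ / Real.sqrt 3 * (v 1 - v 0) = (v 0 + v 1 + v 2) / 3 +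
        Real.sqrt (v 0 ^ 2 + v 1 ^ 2 + v 2 ^ 2 - (v 0 + v 1 + v 2) ^ 2 / 3) *
          (Real.sin (θ + z.arg) * (-2 / Real.sqrt 6))
    rw [hr, e3, e2, Real.sin_add]
    linear_combination 2 * y * Real.sin θ * hc + 2 * y * Real.cos θ * hs +
      2 * Real.cos θ * (v 0 + v 1 - 2 * v 2) * i6

lemma measurable_deltaApprox (ε : ℝ) : Measurable (deltaApprox ε) := by
  unfold deltaApprox
  exact Measurable.ite (measurableSet_lt (by fun_prop) (by fun_prop)) measurable_const
    measurable_const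

lemma deltaApprox_mul_eq {K : ℝ × ℝ → ℝ} {A B : ℝ} {ε : ℝ × ℝ} (h1 : 0 < ε.1) (h2 : 0 < ε.2) :
    ∫ y : ℝ × ℝ, K y * (deltaApprox ε.1 (A - y.1) * deltaApprox ε.2 (B - y.2)) =
      ⨍ y in Metric.ball A ε.1 ×ˢ Metric.ball B ε.2, K y := by
  rw [setAverage_eq, ← integral_indicator (measurableSet_ball.prod measurableSet_ball),
    smul_eq_mul, ← integral_const_mul]
  have hv : (volume : Measure (ℝ × ℝ)).real (Metric.ball A ε.1 ×ˢ Metric.ball B ε.2) =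
      (2 * ε.1) * (2 * ε.2) := by
    rw [Measure.volume_eq_prod, measureReal_prod_prod, Real.volume_real_ball h1.le,
      Real.volume_real_ball h2.le]
  rw [hv]
  congr 1
  ext y
  by_cases hy : y ∈ Metric.ball A ε.1 ×ˢ Metric.ball B ε.2
  · rw [indicator_of_mem hy]
    rw [mem_prod, Metric.mem_ball', Metric.mem_ball', Real.dist_eq, Real.dist_eq] at hy
    rw [deltaApprox, deltaApprox, if_pos hy.1, if_pos hy.2]
    field_simp
  · rw [indicator_of_notMem hy]
    rw [mem_prod, Metric.mem_ball', Metric.mem_ball', Real.dist_eq, Real.dist_eq] at hy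
    rcases not_and_or.1 hy with h | h <;> simp [deltaApprox, h]

lemma average_bound {K : ℝ × ℝ → ℝ} (hK : Measurable K) {C : ℝ} (hC : ∀ y, ‖K y‖ ≤ C)
    {A B : ℝ} {ε : ℝ × ℝ} (h1 : 0 < ε.1) (h2 : 0 < ε.2) {c δ : ℝ}
    (h : ∀ y ∈ Metric.ball A ε.1 ×ˢ Metric.ball B ε.2, K y ∈ Metric.closedBall c δ) :
    ∫ y : ℝ × ℝ, K y * (deltaApprox ε.1 (A - y.1) * deltaApprox ε.2 (B - y.2)) ∈
      Metric.closedBall c δ := by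
  rw [deltaApprox_mul_eq h1 h2]
  have hfin : (volume : Measure (ℝ × ℝ)) (Metric.ball A ε.1 ×ˢ Metric.ball B ε.2) ≠ ⊤ :=
    ((Metric.isBounded_ball.prod Metric.isBounded_ball).measure_lt_top).ne
  refine (convex_closedBall c δ).set_average_mem Metric.isClosed_closedBall ?_ hfin ?_ ?_
  · exact (((Metric.isOpen_ball.prod Metric.isOpen_ball).measure_pos _
      ⟨(A, B), by simp [h1, h2]⟩)).ne'
  · exact (ae_restrict_iff' (measurableSet_ball.prod measurableSet_ball)).2
      (Eventually.of_forall h)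
  · exact Measure.integrableOn_of_bounded hfin hK.aestronglyMeasurable
      (Eventually.of_forall hC)

lemma tendsto_average {K : ℝ × ℝ → ℝ} (hK : Measurable K) {C : ℝ} (hC : ∀ y, ‖K y‖ ≤ C)
    {A B : ℝ} (hcont : ContinuousAt K (A, B)) :
    Tendsto (fun ε : ℝ × ℝ =>
        ∫ y : ℝ × ℝ, K y * (deltaApprox ε.1 (A - y.1) * deltaApprox ε.2 (B - y.2)))
      (𝓝[>] 0 ×ˢ 𝓝[>] 0) (𝓝 (K (A, B))) := by
  rw [Metric.tendsto_nhds]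
  intro δ hδ
  obtain ⟨r, hr, h⟩ := Metric.continuousAt_iff.1 hcont (δ / 2) (by positivity)
  have hI : Ioo (0 : ℝ) r ∈ 𝓝[>] (0 : ℝ) := Ioo_mem_nhdsGT hr
  filter_upwards [prod_mem_prod hI hI] with ε hε
  have := average_bound hK hC (A := A) (B := B) hε.1.1 hε.2.1 (c := K (A, B)) (δ := δ / 2) ?_
  · rw [Metric.mem_closedBall] at this
    linarith
  · intro y hy
    refine Metric.mem_closedBall.2 (h ?_).le
    rw [Prod.dist_eq]
    exact max_lt (lt_trans hy.1 hε.1.2) (lt_trans hy.2 hε.2.2)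

lemma continuous_rot : Continuous fun q : R3 × ℝ => (q.1, rot q.2 q.1) := by
  unfold rot
  fun_prop

lemma abs_deltaApprox_le {ε : ℝ} (h : 0 < ε) (x : ℝ) : |deltaApprox ε x| ≤ 1 / (2 * ε) := by
  unfold deltaApprox
  split_ifs
  · rw [abs_of_pos (by positivity)]
  · rw [abs_zero]; positivity

/-- The plane `v₁ = v₂` is a null set. -/
lemma ae_lt_sq : ∀ᵐ v : R3, (v 0 + v 1 + v 2) ^ 2 / 3 < v 0 ^ 2 + v 1 ^ 2 + v 2 ^ 2 := by
  let S : Submodule ℝ R3 := LinearMap.ker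
    ((LinearMap.proj 0 : R3 →ₗ[ℝ] ℝ) - (LinearMap.proj 1 : R3 →ₗ[ℝ] ℝ))
  have hS : S ≠ ⊤ := by
    intro h
    have : (![1, 0, 0] : R3) ∈ S := h ▸ Submodule.mem_top
    simp [S] at this
  have h0 : (volume : Measure R3) S = 0 := Measure.addHaar_submodule _ S hS
  have : ∀ᵐ v : R3, v ∉ (S : Set R3) := measure_eq_zero_iff_ae_notMem.1 h0
  filter_upwards [this] with v hv
  have hne : v 0 - v 1 ≠ 0 := by simpa [S] using hv
  have : 0 < (v 0 - v 1) ^ 2 := by positivity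
  nlinarith [sq_nonneg (v 0 - v 2), sq_nonneg (v 1 - v 2)]

/-- `deltaMeasure` is the product of the two delta functions: against a test function it is the
limit of the integrals in which both delta functions are replaced by approximate identities. -/
theorem tendsto_integral_deltaMeasure (φ : R3 × R3 → ℝ) (hφ : Continuous φ)
    (hc : HasCompactSupport φ) :
    Tendsto (fun ε : ℝ × ℝ => ∫ p : R3 × R3, φ p *
        (deltaApprox ε.1 (linDefect p) * deltaApprox ε.2 (quadDefect p)))
      (𝓝[>] 0 ×ˢ 𝓝[>] 0) (𝓝 (∫ p, φ p ∂deltaMeasure)) := by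
  obtain ⟨C, hC⟩ := hc.exists_bound_of_continuous hφ
  have hC0 : 0 ≤ C := (norm_nonneg _).trans (hC 0)
  set c : ℝ := 1 / (2 * Real.sqrt 3) with hcdef
  have hc0 : 0 < c := by positivity
  set K : Set R3 := Prod.fst '' tsupport φ with hKdef
  have hK : IsCompact K := hc.isCompact.image continuous_fst
  have hφK : ∀ v ∉ K, ∀ w, φ (v, w) = 0 := fun v hv w =>
    image_eq_zero_of_notMem_tsupport fun h => hv ⟨_, h, rfl⟩
  set A : R3 → ℝ := fun v => v 0 + v 1 + v 2 with hA
  set B : R3 → ℝ := fun v => v 0 ^ 2 + v 1 ^ 2 + v 2 ^ 2 with hB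
  set D : Set (ℝ × ℝ) := {x | x.1 ^ 2 / 3 < x.2} with hDdef
  have hDo : IsOpen D := isOpen_lt (by fun_prop) (by fun_prop)
  have hAm : Measurable A := by fun_prop
  have hBm : Measurable B := by fun_prop
  have hφi : Integrable φ := hφ.integrable_of_hasCompactSupport hc
  set μα : Measure ℝ := (volume : Measure ℝ).restrict (Ioo (-Real.pi) Real.pi) with hμα
  set k : ℝ × ℝ → R3 × R3 → ℝ := fun ε p =>
    deltaApprox ε.1 (A p.1 - A p.2) * deltaApprox ε.2 (B p.1 - B p.2) with hk
  have hkeq : ∀ ε p, deltaApprox ε.1 (linDefect p) * deltaApprox ε.2 (quadDefect p) = k ε p := by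
    intro ε p
    simp only [hk, linDefect, quadDefect, hA, hB]
    congr 2 <;> ring
  have hkm : ∀ ε, Measurable (k ε) := fun ε =>
    ((measurable_deltaApprox _).comp (by fun_prop)).mul
      ((measurable_deltaApprox _).comp (by fun_prop))
  have hkb : ∀ ε : ℝ × ℝ, 0 < ε.1 → 0 < ε.2 → ∀ p,
      ‖k ε p‖ ≤ 1 / (2 * ε.1) * (1 / (2 * ε.2)) := by
    intro ε h1 h2 p
    rw [hk, Real.norm_eq_abs, abs_mul]
    exact mul_le_mul (abs_deltaApprox_le h1 _) (abs_deltaApprox_le h2 _) (abs_nonneg _)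
      (by positivity)
  have hpos : ∀ᶠ ε : ℝ × ℝ in 𝓝[>] 0 ×ˢ 𝓝[>] 0, 0 < ε.1 ∧ 0 < ε.2 :=
    prod_mem_prod self_mem_nhdsWithin self_mem_nhdsWithin
  have hint : ∀ ε : ℝ × ℝ, 0 < ε.1 → 0 < ε.2 → Integrable fun p => φ p * k ε p :=
    fun ε h1 h2 => hφi.mul_bdd (hkm ε).aestronglyMeasurable
      (Eventually.of_forall (hkb ε h1 h2))
  -- the inner average
  set F : R3 → ℝ → ℝ × ℝ → ℝ := fun v α => D.indicator fun y => φ (v, circ (α, y)) with hF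
  set J : ℝ × ℝ → R3 → ℝ → ℝ := fun ε v α =>
    ∫ y : ℝ × ℝ, F v α y * (deltaApprox ε.1 (A v - y.1) * deltaApprox ε.2 (B v - y.2)) with hJ
  have hFm : ∀ v α, Measurable (F v α) := fun v α =>
    ((hφ.comp (by have := continuous_circ; fun_prop)).measurable).indicator hDo.measurableSet
  have hFb : ∀ v α y, ‖F v α y‖ ≤ C := fun v α y =>
    (norm_indicator_le_norm_self _ _).trans (hC _)
  have hJb : ∀ ε : ℝ × ℝ, 0 < ε.1 → 0 < ε.2 → ∀ v α, ‖J ε v α‖ ≤ C := by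
    intro ε h1 h2 v α
    have := average_bound (hFm v α) (hFb v α) (A := A v) (B := B v) h1 h2 (c := 0) (δ := C)
      fun y _ => by simpa using hFb v α y
    simpa using this
  have hae : ∀ᵐ v : R3, Integrable fun w => φ (v, w) := hφi.prod_right_ae
  have hmain : ∀ᵐ v : R3, ∀ ε : ℝ × ℝ, 0 < ε.1 → 0 < ε.2 →
      AEStronglyMeasurable (J ε v) μα ∧ ∫ w, φ (v, w) * k ε (v, w) = c * ∫ α, J ε v α ∂μα := by
    filter_upwards [hae] with v hv ε h1 h2
    have hi : Integrable fun w => φ (v, w) * k ε (v, w) :=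
      hv.mul_bdd ((hkm ε).comp (by fun_prop)).aestronglyMeasurable
        (Eventually.of_forall fun w => hkb ε h1 h2 (v, w))
    have hJeq : ∀ α, ∫ y in D, φ (v, circ (α, y)) * k ε (v, circ (α, y)) = J ε v α := by
      intro α
      rw [hJ, ← integral_indicator hDo.measurableSet]
      refine integral_congr_ae (Eventually.of_forall fun y => ?_)
      by_cases hy : y ∈ D
      · obtain ⟨σ, τ⟩ := y
        simp only [hF, indicator_of_mem hy]
        have e1 : A (circ (α, σ, τ)) = σ := circ_sum α σ τ
        have e2 : B (circ (α, σ, τ)) = τ := circ_sq α σ τ (le_of_lt hy)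
        simp only [hk, e1, e2]
      · simp only [hF, indicator_of_notMem hy, zero_mul]
    have hfm : Measurable fun w => φ (v, w) * k ε (v, w) :=
      (hφ.comp (by fun_prop)).measurable.mul ((hkm ε).comp (by fun_prop))
    have hi' : Integrable (fun q => φ (v, circ q) * k ε (v, circ q))
        (μα.prod ((volume : Measure (ℝ × ℝ)).restrict D)) := by
      have h := hi
      rw [volume_eq_map_circ, integrable_smul_measure
        (ENNReal.ofReal_pos.2 hc0).ne' ENNReal.ofReal_ne_top,
        integrable_map_measure hfm.aestronglyMeasurable
        continuous_circ.measurable.aemeasurable] at h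
      exact h
    refine ⟨?_, ?_⟩
    · have h := hi'.integral_prod_left.aestronglyMeasurable
      simp only [hJeq] at h
      exact h
    · rw [volume_eq_map_circ, integral_smul_measure,
        integral_map continuous_circ.measurable.aemeasurable hfm.aestronglyMeasurable,
        integral_prod _ hi', ENNReal.toReal_ofReal hc0.le, smul_eq_mul]
      simp only [hJeq]
  have hlim : ∀ᵐ v : R3, Tendsto (fun ε : ℝ × ℝ => ∫ w, φ (v, w) * k ε (v, w))
      (𝓝[>] 0 ×ˢ 𝓝[>] 0) (𝓝 (c * ∫ α, φ (v, circ (α, A v, B v)) ∂μα)) := by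
    filter_upwards [hmain, ae_lt_sq] with v hv hlt
    have : Tendsto (fun ε : ℝ × ℝ => ∫ α, J ε v α ∂μα)
        (𝓝[>] 0 ×ˢ 𝓝[>] 0) (𝓝 (∫ α, φ (v, circ (α, A v, B v)) ∂μα)) := by
      refine tendsto_integral_filter_of_dominated_convergence (fun _ => C) ?_ ?_
        (integrable_const _) ?_
      · filter_upwards [hpos] with ε hε using (hv ε hε.1 hε.2).1
      · filter_upwards [hpos] with ε hε
        exact Eventually.of_forall (hJb ε hε.1 hε.2 v)
      · refine Eventually.of_forall fun α => ?_
        have hm : (A v, B v) ∈ D := hlt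
        have hev : F v α =ᶠ[𝓝 (A v, B v)] fun y => φ (v, circ (α, y)) := by
          filter_upwards [hDo.mem_nhds hm] with y hy
          simp only [hF, indicator_of_mem hy]
        have hcont : ContinuousAt (F v α) (A v, B v) := by
          refine ContinuousAt.congr ?_ hev.symm
          exact (hφ.comp (by have := continuous_circ; fun_prop)).continuousAt
        have := tendsto_average (hFm v α) (hFb v α) hcont
        rwa [hev.eq_of_nhds] at this
    refine (this.const_mul c).congr' ?_
    filter_upwards [hpos] with ε hε using ((hv ε hε.1 hε.2).2).symm
  have hrhs : ∫ p, φ p ∂deltaMeasure = ∫ v : R3, c * ∫ α, φ (v, circ (α, A v, B v)) ∂μα := by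
    have hri : Integrable (fun q : R3 × ℝ => φ (q.1, rot q.2 q.1))
        ((volume : Measure R3).prod ((volume : Measure ℝ).restrict (Ioc 0 (2 * Real.pi)))) := by
      have hKm : MeasurableSet (K ×ˢ (univ : Set ℝ)) := hK.measurableSet.prod MeasurableSet.univ
      refine Integrable.mono' (g := (K ×ˢ (univ : Set ℝ)).indicator fun _ => C) ?_
        (hφ.comp continuous_rot).aestronglyMeasurable (Eventually.of_forall fun q => ?_)
      · refine (integrable_indicator_iff hKm).2 (integrableOn_const ?_)
        rw [Measure.prod_prod]
        refine ENNReal.mul_ne_top hK.measure_lt_top.ne (measure_ne_top _ _)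
      · by_cases hq : q.1 ∈ K
        · rw [indicator_of_mem (by exact ⟨hq, trivial⟩)]
          exact hC _
        · rw [hφK _ hq, norm_zero]
          exact indicator_nonneg (fun _ _ => hC0) _
    rw [deltaMeasure, integral_smul_measure, integral_map continuous_rot.measurable.aemeasurable
      hφ.aestronglyMeasurable, integral_prod _ hri, ENNReal.toReal_ofReal hc0.le,
      integral_const_mul, smul_eq_mul]
    congr 1
    refine integral_congr_ae (Eventually.of_forall fun v => ?_)
    obtain ⟨α₀, hα⟩ := exists_rot_eq_circ v
    simp only [hα]
    set G : ℝ → ℝ := fun α => φ (v, circ (α, A v, B v)) with hG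
    have hper : Function.Periodic G (2 * Real.pi) := by
      intro α
      simp only [hG, circ, Real.cos_add_two_pi, Real.sin_add_two_pi]
    have hp := Real.pi_pos
    change ∫ θ in Ioc 0 (2 * Real.pi), G (θ + α₀) = ∫ α in Ioo (-Real.pi) Real.pi, G α
    rw [← integral_Ioc_eq_integral_Ioo, ← intervalIntegral.integral_of_le (by linarith),
      ← intervalIntegral.integral_of_le (by linarith), intervalIntegral.integral_comp_add_right,
      zero_add, add_comm (2 * Real.pi) α₀, hper.intervalIntegral_add_eq α₀ (-Real.pi)]
    congr 1
    ring
  rw [hrhs]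
  simp only [hkeq]
  have hstep : ∀ᶠ ε : ℝ × ℝ in 𝓝[>] 0 ×ˢ 𝓝[>] 0,
      ∫ v, ∫ w, φ (v, w) * k ε (v, w) = ∫ p : R3 × R3, φ p * k ε p := by
    filter_upwards [hpos] with ε hε
    rw [Measure.volume_eq_prod, integral_prod _ (hint ε hε.1 hε.2)]
  refine Tendsto.congr' hstep ?_
  refine tendsto_integral_filter_of_dominated_convergence
    (K.indicator fun _ => c * (C * (2 * Real.pi))) ?_ ?_ ?_ hlim
  · filter_upwards [hpos] with ε hε
    exact (hint ε hε.1 hε.2).integral_prod_left.aestronglyMeasurable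
  · filter_upwards [hpos] with ε hε
    filter_upwards [hmain] with v hv
    by_cases hvK : v ∈ K
    · rw [indicator_of_mem hvK, (hv ε hε.1 hε.2).2, norm_mul, Real.norm_of_nonneg hc0.le]
      refine mul_le_mul_of_nonneg_left ?_ hc0.le
      have := norm_integral_le_of_norm_le_const (μ := μα)
        (Eventually.of_forall (hJb ε hε.1 hε.2 v))
      refine this.trans (le_of_eq ?_)
      have hp := Real.pi_pos
      rw [hμα, measureReal_restrict_apply_univ, Real.volume_real_Ioo_of_le (by linarith)]
      ring
    · rw [indicator_of_notMem hvK]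
      simp [hφK v hvK]
  · exact (integrable_indicator_iff hK.measurableSet).2
      (integrableOn_const hK.measure_lt_top.ne)

end

end Strichartz

namespace Strichartz

open scoped ENNReal SchwartzMap

/-! ### The rotations -/

/-! The proof bootstraps exponential weights. On the support of the two deltas, `w = rot θ v`, so
the sums of squares agree and `ξ₁²` is at most the sum of the other five squares. Since truncation
at `n` is subadditive, the weight `exp (min (μ ξ²) n)` at `ξ₁` is bounded by the product of the
weights at the other frequencies (`weight_le_mul`). Let `h` be the weighted modulus of `f̂` and `u`
its part on `|ξ| > s²`. Testing the equation with `ĝ` equal to the squared weight times `f̂` on `|ξ|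
> s²` bounds a multiple of `‖u‖²` by the form with `u` in the first slot and `h` in the others
(`l2norm_indicator_sq_le`).

For each angle the form is bounded by the product of the `L²` norms, by Cauchy-Schwarz (`slice_le`).
This alone gives only a term linear in `‖u‖` with no small constant after division by `‖u‖`. The
gain is geometric (`exists_mid_or_exists_two_large`): unless the angle almost moves the first axis
into a coordinate plane, a frequency `|ξ₁| > s²` forces either another frequency into `(s, s²]`,
where `h` has small norm, or two others above `s²`, which yields the cubic term `‖u‖³`. The
exceptional angles have small measure.

With `μ = 1 / s ^ 4` the weight is at most `e` on `|ξ| ≤ s²`, and `ν = ‖u‖` satisfies `κ ν ≤ small +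
C ν² + small` as long as `ν ≤ 1` (`high_le`). This excludes values of `ν` between `η` and `3η`. At
`n = 0` the norm is a tail of `f̂`, hence at most `η`, and passing from `n` to `n + 1` multiplies it
by at most `e < 3`, so it stays below `η` for every `n`. Fatou's lemma removes the truncation.
Gaussian decay then makes the Fourier-Laplace integral converge on all of `ℂ`, which gives the
entire extension. -/

lemma rot_sq (θ : ℝ) (v : R3) :
    rot θ v 0 ^ 2 + rot θ v 1 ^ 2 + rot θ v 2 ^ 2 = v 0 ^ 2 + v 1 ^ 2 + v 2 ^ 2 := by
  obtain ⟨α, h⟩ := exists_rot_eq_circ v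
  rw [h, circ_sq]
  nlinarith [sq_nonneg (v 0 - v 2), sq_nonneg (v 1 - v 2), sq_nonneg (v 0 - v 1)]

/-- `rot θ` as a linear map. -/
noncomputable def rotLinear (θ : ℝ) : R3 →ₗ[ℝ] R3 where
  toFun := rot θ
  map_add' v w := by
    ext i
    simp only [rot, Pi.add_apply]
    ring
  map_smul' r v := by
    ext i
    simp only [rot, Pi.smul_apply, smul_eq_mul, RingHom.id_apply]
    ring

lemma rotLinear_apply (θ : ℝ) (v : R3) : rotLinear θ v = rot θ v := rfl

lemma det_rotLinear (θ : ℝ) : LinearMap.det (rotLinear θ) = 1 := by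
  have h3 : (Real.sqrt 3)⁻¹ ^ 2 = 1 / 3 := by
    rw [inv_pow, Real.sq_sqrt (by norm_num)]; norm_num
  have hc := Real.sin_sq_add_cos_sq θ
  rw [← LinearMap.det_toMatrix', Matrix.det_fin_three]
  simp only [LinearMap.toMatrix'_apply, rotLinear_apply, rot, Pi.single_apply]
  simp [div_eq_mul_inv]
  generalize (√3)⁻¹ = t at *
  generalize Real.sin θ = s at *
  generalize Real.cos θ = c at *
  linear_combination (3 * s ^ 2) * h3 + hc

lemma measurePreserving_rot (θ : ℝ) : MeasurePreserving (rot θ) volume volume := by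
  refine ⟨?_, ?_⟩
  · exact (LinearMap.continuous_of_finiteDimensional (rotLinear θ)).measurable
  · have h := Real.map_linearMap_volume_pi_eq_smul_volume_pi (f := rotLinear θ)
      (by rw [det_rotLinear]; exact one_ne_zero)
    rw [det_rotLinear] at h
    change Measure.map (rotLinear θ) volume = volume
    simpa using h

/-! ### The sliced form and the Cauchy-Schwarz inequality -/

/-- The `L²` norm of a nonnegative function. -/
noncomputable def l2norm (g : ℝ → ℝ≥0∞) : ℝ≥0∞ := (∫⁻ x, g x ^ 2) ^ (1 / 2 : ℝ)

lemma l2norm_sq (g : ℝ → ℝ≥0∞) : l2norm g ^ 2 = ∫⁻ x, g x ^ 2 := by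
  rw [l2norm, ← ENNReal.rpow_natCast, ← ENNReal.rpow_mul]
  norm_num

lemma l2norm_mono {g h : ℝ → ℝ≥0∞} (H : ∀ x, g x ≤ h x) : l2norm g ≤ l2norm h :=
  ENNReal.rpow_le_rpow (lintegral_mono fun x => pow_le_pow_left' (H x) 2) (by norm_num)

lemma l2norm_const_mul (c : ℝ≥0∞) (hc : c ≠ ∞) (g : ℝ → ℝ≥0∞) :
    l2norm (fun x => c * g x) = c * l2norm g := by
  simp only [l2norm, mul_pow]
  rw [lintegral_const_mul' _ _ (ENNReal.pow_ne_top hc),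
    ENNReal.mul_rpow_of_nonneg _ _ (by norm_num), ← ENNReal.rpow_natCast, ← ENNReal.rpow_mul]
  norm_num

lemma l2norm_add_le {g h : ℝ → ℝ≥0∞} (hg : Measurable g) (hh : Measurable h) :
    l2norm (fun x => g x + h x) ≤ l2norm g + l2norm h := by
  have := ENNReal.lintegral_Lp_add_le (μ := volume) hg.aemeasurable hh.aemeasurable
    (p := 2) (by norm_num)
  simpa [l2norm] using this

lemma lintegral_fin_prod_eq_prod_lintegral : ∀ (n : ℕ) (g : Fin n → ℝ → ℝ≥0∞),
    (∀ i, Measurable (g i)) → ∫⁻ v : Fin n → ℝ, ∏ i, g i (v i) = ∏ i, ∫⁻ x, g i x := by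
  intro n
  induction n with
  | zero => intro g _; simp [volume_pi]
  | succ n ih =>
    intro g hg
    have a := volume_preserving_piFinSuccAbove (fun _ : Fin (n + 1) => ℝ) 0
    have hm : Measurable fun v : Fin (n + 1) → ℝ => ∏ i, g i (v i) := by fun_prop
    rw [← a.symm.lintegral_comp hm, Measure.volume_eq_prod]
    simp only [Fin.prod_univ_succ]
    rw [← ih (fun i => g i.succ) (fun i => hg _)]
    rw [← lintegral_prod_mul (hg 0).aemeasurable
      (g := fun v : Fin n → ℝ => ∏ i, g i.succ (v i))]
    · rfl
    · exact (Finset.measurable_prod _ fun i _ => (hg i.succ).comp (measurable_pi_apply i)).aemeasurable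

/-- The integral of `∏ gⱼ(ξⱼ)` over the graph of the rotation by `θ`. -/
noncomputable def slice (θ : ℝ) (g : Fin 3 ⊕ Fin 3 → ℝ → ℝ≥0∞) : ℝ≥0∞ :=
  ∫⁻ v : R3, ∏ j, g j (Sum.elim v (rot θ v) j)

/-- Cauchy-Schwarz separates the functions of `v` from those of `rot θ v`. The rotation preserves
volume, so both factors are integrals of product functions and split by Tonelli. The bound is
uniform in `θ`. -/
lemma slice_le (θ : ℝ) (g : Fin 3 ⊕ Fin 3 → ℝ → ℝ≥0∞) (hg : ∀ j, Measurable (g j)) :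
    slice θ g ≤ ∏ j, l2norm (g j) := by
  have key : ∀ k : Fin 3 → ℝ → ℝ≥0∞, (∀ j, Measurable (k j)) →
      (∫⁻ v : R3, (∏ i, k i (v i)) ^ (2 : ℝ)) ^ (1 / 2 : ℝ) = ∏ i, l2norm (k i) := by
    intro k hk
    have : ∀ v : R3, (∏ i, k i (v i)) ^ (2 : ℝ) = ∏ i, (fun x => k i x ^ 2) (v i) := by
      intro v
      rw [Finset.prod_pow]
      norm_cast
    simp only [this]
    rw [lintegral_fin_prod_eq_prod_lintegral 3 (fun i x => k i x ^ 2) (fun i => (hk i).pow_const 2),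
      ← ENNReal.prod_rpow_of_nonneg (by norm_num)]
    rfl
  have hm : ∀ k : Fin 3 → ℝ → ℝ≥0∞, (∀ j, Measurable (k j)) →
      Measurable fun v : R3 => ∏ i, k i (v i) := fun k hk =>
    Finset.measurable_prod _ fun i _ => (hk i).comp (measurable_pi_apply i)
  simp only [slice, Fintype.prod_sum_type, Sum.elim_inl, Sum.elim_inr]
  refine (ENNReal.lintegral_mul_le_Lp_mul_Lq volume Real.HolderConjugate.two_two
    (hm _ fun i => hg (Sum.inl i)).aemeasurable
    ((hm _ fun i => hg (Sum.inr i)).comp (measurePreserving_rot θ).measurable).aemeasurable).trans ?_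
  rw [key (fun i => g (Sum.inl i)) (fun i => hg _)]
  have e := (measurePreserving_rot θ).lintegral_comp
    ((hm _ fun i => hg (Sum.inr i)).pow_const (2 : ℝ))
  have k2 := key (fun i => g (Sum.inr i)) (fun i => hg _)
  simp only [Function.comp_apply] at *
  rw [e, k2]

/-! ### Angles for which the first axis is rotated close to a coordinate plane -/

/-- The three coordinates of the rotated axis are one cosine profile shifted by `0` and `∓2π/3`.
They vanish only where the cosine is `-1/2`, which is a countable set of angles. -/
lemma exists_rot_axis_eq_cos (i : Fin 3) :
    ∃ φ : ℝ, ∀ θ, rot θ (Pi.single 0 1) i = (1 + 2 * Real.cos (θ + φ)) / 3 := by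
  have h3 : Real.sqrt 3 ^ 2 = 3 := Real.sq_sqrt (by norm_num)
  have hp : Real.sqrt 3 ≠ 0 := by positivity
  have hs : ∀ θ, Real.sin θ / Real.sqrt 3 = Real.sin θ * Real.sqrt 3 / 3 := by
    intro θ
    field_simp
    linear_combination -(Real.sin θ) * h3
  fin_cases i
  · refine ⟨0, fun θ => ?_⟩
    simp [rot]
    ring
  · refine ⟨-(Real.pi - Real.pi / 3), fun θ => ?_⟩
    have : rot θ (Pi.single 0 1) 1 = 1 / 3 - Real.cos θ / 3 + Real.sin θ / Real.sqrt 3 := by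
      simp [rot]
      ring
    rw [Fin.mk_one, this, hs, Real.cos_add, Real.cos_neg, Real.sin_neg, Real.cos_pi_sub,
      Real.sin_pi_sub, Real.cos_pi_div_three, Real.sin_pi_div_three]
    ring
  · refine ⟨Real.pi - Real.pi / 3, fun θ => ?_⟩
    have : rot θ (Pi.single 0 1) 2 = 1 / 3 - Real.cos θ / 3 - Real.sin θ / Real.sqrt 3 := by
      simp [rot]
      ring
    rw [show (⟨2, by norm_num⟩ : Fin 3) = 2 from rfl, this, hs, Real.cos_add, Real.cos_pi_sub,
      Real.sin_pi_sub, Real.cos_pi_div_three, Real.sin_pi_div_three]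
    ring

lemma volume_rot_axis_eq_zero (i : Fin 3) :
    volume {θ : ℝ | rot θ (Pi.single 0 1) i = 0} = 0 := by
  obtain ⟨φ, h⟩ := exists_rot_axis_eq_cos i
  have hsub : {θ : ℝ | rot θ (Pi.single 0 1) i = 0} ⊆
      (⋃ k : ℤ, {2 * k * Real.pi + (Real.pi - Real.pi / 3) - φ}) ∪
        ⋃ k : ℤ, {2 * k * Real.pi - (Real.pi - Real.pi / 3) - φ} := by
    intro θ hθ
    rw [mem_ofPred_eq, h] at hθ
    have : Real.cos (Real.pi - Real.pi / 3) = Real.cos (θ + φ) := by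
      rw [Real.cos_pi_sub, Real.cos_pi_div_three]
      linarith
    obtain ⟨k, hk | hk⟩ := Real.cos_eq_cos_iff.1 this
    · left
      exact mem_iUnion.2 ⟨k, by rw [mem_singleton_iff]; linarith⟩
    · right
      exact mem_iUnion.2 ⟨k, by rw [mem_singleton_iff]; linarith⟩
  exact ((countable_iUnion fun _ => countable_singleton _).union
    (countable_iUnion fun _ => countable_singleton _)).mono hsub |>.measure_zero _

/-- The angles for which some coordinate of the rotated first basis vector is at most `δ`. -/
def smallAngles (δ : ℝ) : Set ℝ := {θ | ∃ i, |rot θ (Pi.single 0 1) i| ≤ δ}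

lemma continuous_rot_axis (i : Fin 3) : Continuous fun θ => rot θ (Pi.single 0 1) i := by
  unfold rot
  fun_prop

lemma smallAngles_eq (δ : ℝ) :
    smallAngles δ = ⋃ i, {θ | |rot θ (Pi.single 0 1) i| ≤ δ} := by
  ext θ; simp [smallAngles]

lemma measurableSet_smallAngles (δ : ℝ) : MeasurableSet (smallAngles δ) := by
  rw [smallAngles_eq]
  exact MeasurableSet.iUnion fun i =>
    (isClosed_le (continuous_rot_axis i).abs continuous_const).measurableSet

/-- As `δ` decreases to `0` these sets shrink to the null set where some coordinate vanishes.
Continuity from above of a finite measure suffices, and no rate in `δ` is needed. -/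
lemma exists_smallAngles_measure_le {ε : ℝ≥0∞} (hε : 0 < ε) :
    ∃ δ > 0, volume.restrict (Ioc 0 (2 * Real.pi)) (smallAngles δ) ≤ ε := by
  set m : Measure ℝ := volume.restrict (Ioc 0 (2 * Real.pi)) with hm
  have hanti : Antitone fun n : ℕ => smallAngles (1 / ((n : ℝ) + 1)) := by
    intro a b hab θ hθ
    obtain ⟨i, hi⟩ := hθ
    exact ⟨i, hi.trans (one_div_le_one_div_of_le (by positivity) (by exact_mod_cast by omega))⟩
  have hnull : m (⋂ n : ℕ, smallAngles (1 / ((n : ℝ) + 1))) = 0 := by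
    refine measure_mono_null (t := ⋃ i, {θ : ℝ | rot θ (Pi.single 0 1) i = 0}) ?_ ?_
    · intro θ hθ
      by_contra hcon
      simp only [mem_iUnion, mem_ofPred_eq, not_exists] at hcon
      have hex : ∃ r > 0, ∀ i, r < |rot θ (Pi.single 0 1) i| := by
        obtain ⟨i₀, h₀⟩ := Finite.exists_min fun i => |rot θ (Pi.single 0 1) i|
        have := abs_pos.2 (hcon i₀)
        exact ⟨|rot θ (Pi.single 0 1) i₀| / 2, by positivity, fun i => by
          have := h₀ i; linarith⟩
      obtain ⟨r, hr, h⟩ := hex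
      obtain ⟨n, hn⟩ := exists_nat_one_div_lt hr
      obtain ⟨i, hi⟩ := mem_iInter.1 hθ n
      exact absurd (h i) (not_lt.2 (hi.trans hn.le))
    · refine measure_iUnion_null fun i => ?_
      exact Measure.absolutelyContinuous_of_le Measure.restrict_le_self (volume_rot_axis_eq_zero i)
  have ht := tendsto_measure_iInter_atTop (μ := m)
    (fun n : ℕ => (measurableSet_smallAngles (1 / ((n : ℝ) + 1))).nullMeasurableSet) hanti
    ⟨0, measure_ne_top _ _⟩
  rw [hnull] at ht
  obtain ⟨n, hn⟩ := (ht.eventually_le_const hε).exists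
  exact ⟨_, by positivity, hn⟩

/-- If `ξ₁` is large and the angle is not small, then another frequency is in the middle range or
two other frequencies are large. -/
lemma exists_mid_or_exists_two_large {s δ θ : ℝ} (hs : 3 ≤ s) (hδ : 3 ≤ δ * s)
    (hθ : θ ∉ smallAngles δ) {v : R3} (hv : s ^ 2 < |v 0|) :
    (∃ j ≠ Sum.inl 0, s < |Sum.elim v (rot θ v) j| ∧ |Sum.elim v (rot θ v) j| ≤ s ^ 2) ∨
    ∃ j ≠ Sum.inl 0, ∃ k ≠ Sum.inl 0, j ≠ k ∧ s ^ 2 < |Sum.elim v (rot θ v) j| ∧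
      s ^ 2 < |Sum.elim v (rot θ v) k| := by
  by_contra! hcon
  obtain ⟨hmid, htwo⟩ := hcon
  have hsq : ∀ x : ℝ, |x| ≤ s → x ^ 2 ≤ s ^ 2 := fun x hx => by
    rw [← sq_abs]; exact pow_le_pow_left₀ (abs_nonneg _) hx 2
  -- With the middle range empty, each other frequency is either at most `s` or above `s²`, and at
  -- most one of the five is above `s²`.
  have hlow : ∀ j ≠ Sum.inl 0, |Sum.elim v (rot θ v) j| ≤ s ^ 2 →
      |Sum.elim v (rot θ v) j| ≤ s := by
    intro j hj hle
    by_contra! h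
    exact absurd (hmid j hj h) (not_lt.2 hle)
  have hen := rot_sq θ v
  have hv2 : (s ^ 2) ^ 2 < v 0 ^ 2 := by
    rw [← sq_abs (v 0)]; exact pow_lt_pow_left₀ hv (by positivity) two_ne_zero
  have hs9 : 9 ≤ s ^ 2 := by nlinarith
  -- the other two of the first three frequencies are small
  have hfirst : ∀ i : Fin 3, i ≠ 0 → |v i| ≤ s := by
    intro i hi
    refine hlow (Sum.inl i) (by simpa using hi) ?_
    -- A second large frequency on the `v` side leaves all of `rot θ v` at most `s`, so its square
    -- norm is at most `3 s²`. This is less than `s⁴ < (v 0)²` because `s² ≥ 9`, contradicting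
    -- `rot_sq`.
    by_contra! hbig
    have hw : ∀ k : Fin 3, rot θ v k ^ 2 ≤ s ^ 2 := fun k =>
      hsq _ (hlow (Sum.inr k) (by simp)
        (htwo (Sum.inl i) (by simpa using hi) (Sum.inr k) (by simp) (by simp) hbig))
    nlinarith [hw 0, hw 1, hw 2, sq_nonneg (v 1), sq_nonneg (v 2)]
  -- At most one coordinate of `rot θ v` is large, so one of the first two is already small.
  obtain ⟨i, hi⟩ : ∃ i : Fin 3, |rot θ v i| ≤ s := by
    by_contra! h
    have h0 : s ^ 2 < |rot θ v 0| := by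
      by_contra! hc
      exact absurd (hlow (Sum.inr 0) (by simp) hc) (not_le.2 (h 0))
    exact absurd (hlow (Sum.inr 1) (by simp)
      (htwo (Sum.inr 0) (by simp) (Sum.inr 1) (by simp) (by simp) h0)) (not_le.2 (h 1))
  have hθi : δ < |rot θ (Pi.single 0 1) i| := by
    by_contra! h; exact hθ ⟨i, h⟩
  set v' : R3 := ![0, v 1, v 2] with hv'
  have hdec : v = v 0 • (Pi.single 0 1 : R3) + v' := by
    ext k
    fin_cases k <;> simp [hv']
  have hrot : rot θ v i = v 0 * rot θ (Pi.single 0 1) i + rot θ v' i := by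
    conv_lhs => rw [hdec]
    rw [← rotLinear_apply, map_add, map_smul]
    rfl
  have hen' := rot_sq θ v'
  -- The remainder `v'` has square norm at most `2 s²`, and the rotation preserves it.
  have hv'i : |rot θ v' i| ≤ 2 * s := by
    refine abs_le_of_sq_le_sq ?_ (by linarith)
    have e0 : v' 0 = 0 := rfl
    have e1 : v' 1 = v 1 := rfl
    have e2 : v' 2 = v 2 := rfl
    rw [e0, e1, e2] at hen'
    have h1 := hsq _ (hfirst 1 (by decide))
    have h2 := hsq _ (hfirst 2 (by decide))
    have : rot θ v' i ^ 2 ≤ rot θ v' 0 ^ 2 + rot θ v' 1 ^ 2 + rot θ v' 2 ^ 2 := by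
      fin_cases i <;> simp <;> nlinarith [sq_nonneg (rot θ v' 0), sq_nonneg (rot θ v' 1),
        sq_nonneg (rot θ v' 2)]
    nlinarith
  have hprod : |v 0| * |rot θ (Pi.single 0 1) i| ≤ 3 * s := by
    rw [← abs_mul, show v 0 * rot θ (Pi.single 0 1) i = rot θ v i - rot θ v' i by rw [hrot]; ring]
    exact (abs_sub _ _).trans (by linarith)
  have hδ0 : 0 < δ := by
    by_contra! h; nlinarith
  -- The contribution of the first axis exceeds `s² δ ≥ 3 s`, while `hprod` bounds it by `3 s`.
  have : s ^ 2 * δ < |v 0| * |rot θ (Pi.single 0 1) i| :=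
    mul_lt_mul'' hv hθi (by positivity) hδ0.le
  nlinarith

/-! ### The bound for the integral of the slices over the angles -/

lemma prod_update_update {ι : Type*} [Fintype ι] [DecidableEq ι] {M : Type*} [CommMonoid M]
    {i j : ι} (hij : j ≠ i) (a b c : M) :
    ∏ k, Function.update (Function.update (fun _ => a) i b) j c k =
      c * (b * a ^ (Fintype.card ι - 2)) := by
  rw [Finset.prod_update_of_mem (Finset.mem_univ _), Finset.prod_update_of_mem (by simpa using hij.symm),
    Finset.prod_const]
  congr 3
  rw [Finset.card_sdiff_of_subset (by simpa using hij.symm),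
    Finset.card_sdiff_of_subset (by simp)]
  simp
  omega

lemma prod_update_update_update {ι : Type*} [Fintype ι] [DecidableEq ι] {M : Type*} [CommMonoid M]
    {i j k : ι} (hij : j ≠ i) (hik : k ≠ i) (hjk : k ≠ j) (a b c d : M) :
    ∏ l, Function.update (Function.update (Function.update (fun _ => a) i b) j c) k d l =
      d * (c * (b * a ^ (Fintype.card ι - 3))) := by
  rw [Finset.prod_update_of_mem (Finset.mem_univ _), Finset.prod_update_of_mem (by simpa using hjk.symm),
    Finset.prod_update_of_mem (by simpa using ⟨hik.symm, hij.symm⟩), Finset.prod_const]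
  congr 4
  rw [Finset.card_sdiff_of_subset, Finset.card_sdiff_of_subset, Finset.card_sdiff_of_subset (by simp)]
  · simp
    omega
  · simpa using hjk.symm
  · simpa using ⟨hik.symm, hij.symm⟩

/-- The functions in the form tested with the high frequency part. -/
def tested (u h : ℝ → ℝ≥0∞) : Fin 3 ⊕ Fin 3 → ℝ → ℝ≥0∞ :=
  Function.update (fun _ => h) (Sum.inl 0) u

lemma measurable_tested {u h : ℝ → ℝ≥0∞} (hu : Measurable u) (hh : Measurable h)
    (j : Fin 3 ⊕ Fin 3) : Measurable (tested u h j) := by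
  unfold tested
  by_cases hj : j = Sum.inl 0
  · subst hj; simpa
  · rw [Function.update_of_ne hj]; exact hh

lemma measurable_update {ι : Type*} [DecidableEq ι] {g : ι → ℝ → ℝ≥0∞}
    (hg : ∀ j, Measurable (g j)) {m : ℝ → ℝ≥0∞} (hm : Measurable m) (i j : ι) :
    Measurable (Function.update g i m j) := by
  by_cases hj : j = i
  · subst hj; simpa
  · rw [Function.update_of_ne hj]; exact hg j

/-- The crude bound, valid for every angle. It is used on the exceptional angles, where smallness
comes from their measure. -/
lemma slice_tested_le {u h : ℝ → ℝ≥0∞} (hu : Measurable u) (hh : Measurable h) (θ : ℝ) :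
    slice θ (tested u h) ≤ l2norm u * l2norm h ^ 5 := by
  refine (slice_le θ _ (measurable_tested hu hh)).trans (le_of_eq ?_)
  have : ∀ j, l2norm (tested u h j) =
      Function.update (fun _ => l2norm h) (Sum.inl 0) (l2norm u) j := fun j =>
    Function.apply_update (fun _ => l2norm) _ _ _ j
  simp only [this]
  rw [Finset.prod_update_of_mem (Finset.mem_univ _), Finset.prod_const,
    Finset.card_sdiff_of_subset (by simp)]
  simp

/-- The frequency dichotomy allows one factor `h` to be replaced by `m`, or two by `u`, at each
point. Summing over all choices, the constants count the `5` remaining slots and the `20` ordered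
pairs of distinct ones, and `slice_le` bounds each term. -/
lemma slice_tested_le_of_notMem {s δ θ : ℝ} (hs : 3 ≤ s) (hδ : 3 ≤ δ * s)
    (hθ : θ ∉ smallAngles δ) {u m h : ℝ → ℝ≥0∞} (hu : Measurable u) (hm : Measurable m)
    (hh : Measurable h) (hum : ∀ ξ, |ξ| ≤ s ^ 2 → u ξ = 0) (huh : ∀ ξ, s ^ 2 < |ξ| → h ξ = u ξ)
    (hmh : ∀ ξ, s < |ξ| → |ξ| ≤ s ^ 2 → h ξ = m ξ) :
    slice θ (tested u h) ≤ 5 * (l2norm m * (l2norm u * l2norm h ^ 4)) +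
      20 * (l2norm u * (l2norm u * (l2norm u * l2norm h ^ 3))) := by
  set o : Fin 3 ⊕ Fin 3 := Sum.inl 0 with ho
  set S : Finset (Fin 3 ⊕ Fin 3) := Finset.univ.erase o with hS
  set g := tested u h with hg
  have hgm := measurable_tested hu hh
  set g₁ : Fin 3 ⊕ Fin 3 → Fin 3 ⊕ Fin 3 → ℝ → ℝ≥0∞ := fun j => Function.update g j m with hg₁
  set g₂ : (Fin 3 ⊕ Fin 3) × (Fin 3 ⊕ Fin 3) → Fin 3 ⊕ Fin 3 → ℝ → ℝ≥0∞ :=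
    fun p => Function.update (Function.update g p.1 u) p.2 u with hg₂
  have hg₁m : ∀ j i, Measurable (g₁ j i) := fun j i => measurable_update hgm hm _ _
  have hg₂m : ∀ p i, Measurable (g₂ p i) := fun p i =>
    measurable_update (measurable_update hgm hu _) hu _ _
  have hmeas : ∀ k : Fin 3 ⊕ Fin 3 → ℝ → ℝ≥0∞, (∀ j, Measurable (k j)) →
      Measurable fun v : R3 => ∏ j, k j (Sum.elim v (rot θ v) j) := by
    intro k hk
    refine Finset.measurable_prod _ fun j _ => (hk j).comp ?_
    have := (measurePreserving_rot θ).measurable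
    rcases j with i | i
    · exact measurable_pi_apply i
    · exact (measurable_pi_apply i).comp this
  have hgne : ∀ j, j ≠ o → g j = h := fun j hj => Function.update_of_ne hj _ _
  have hpt : ∀ v : R3, ∏ j, g j (Sum.elim v (rot θ v) j) ≤
      (∑ j ∈ S, ∏ i, g₁ j i (Sum.elim v (rot θ v) i)) +
        ∑ p ∈ S.offDiag, ∏ i, g₂ p i (Sum.elim v (rot θ v) i) := by
    intro v
    by_cases hv : s ^ 2 < |v 0|
    · rcases exists_mid_or_exists_two_large hs hδ hθ hv with
        ⟨j, hj, h1, h2⟩ | ⟨j, hj, k, hk, hjk, h1, h2⟩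
      · refine le_trans ?_ le_self_add
        have hjS : j ∈ S := by simp [hS, hj, ho]
        refine le_trans (le_of_eq ?_) (Finset.single_le_sum (fun _ _ => zero_le) hjS)
        refine Finset.prod_congr rfl fun i _ => ?_
        by_cases hi : i = j
        · subst hi
          simp only [hg₁, Function.update_self, hgne i hj]
          exact hmh _ h1 h2
        · simp only [hg₁, Function.update_of_ne hi]
      · refine le_trans ?_ le_add_self
        have hpS : (j, k) ∈ S.offDiag := by simp [hS, hj, hk, ho, hjk]
        refine le_trans (le_of_eq ?_) (Finset.single_le_sum (fun _ _ => zero_le) hpS)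
        refine Finset.prod_congr rfl fun i _ => ?_
        by_cases hi : i = k
        · subst hi
          simp only [hg₂, Function.update_self, hgne i hk]
          exact huh _ h2
        · by_cases hi' : i = j
          · subst hi'
            simp only [hg₂, Function.update_of_ne hi, Function.update_self, hgne i hj]
            exact huh _ h1
          · simp only [hg₂, Function.update_of_ne hi, Function.update_of_ne hi']
    -- If `ξ₁` is not large, the factor `u` vanishes and so does the whole product.
    · rw [Finset.prod_eq_zero (Finset.mem_univ o)]
      · exact zero_le
      · simp only [hg, tested, ho, Function.update_self, Sum.elim_inl]
        exact hum _ (not_lt.1 hv)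
  have hcard : S.card = 5 := by simp [hS]
  have hcard2 : S.offDiag.card = 20 := by rw [Finset.offDiag_card, hcard]
  calc slice θ g ≤ ∫⁻ v : R3, ((∑ j ∈ S, ∏ i, g₁ j i (Sum.elim v (rot θ v) i)) +
        ∑ p ∈ S.offDiag, ∏ i, g₂ p i (Sum.elim v (rot θ v) i)) := lintegral_mono hpt
    _ = (∑ j ∈ S, slice θ (g₁ j)) + ∑ p ∈ S.offDiag, slice θ (g₂ p) := by
      rw [lintegral_add_left (Finset.measurable_sum _ fun j _ => hmeas _ (hg₁m j)),
        lintegral_finsetSum _ fun j _ => hmeas _ (hg₁m j),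
        lintegral_finsetSum _ fun p _ => hmeas _ (hg₂m p)]
      rfl
    _ ≤ _ := by
      refine add_le_add ?_ ?_
      · refine (Finset.sum_le_card_nsmul _ _ _ fun j hj => ?_).trans
          (le_of_eq (by rw [hcard, nsmul_eq_mul]; rfl))
        have hj' : j ≠ o := by simpa [hS] using hj
        refine (slice_le θ _ (hg₁m j)).trans (le_of_eq ?_)
        have : ∀ i, l2norm (g₁ j i) = Function.update (Function.update
            (fun _ => l2norm h) o (l2norm u)) j (l2norm m) i := by
          intro i
          simp only [hg₁, hg, tested, Function.apply_update (fun _ => l2norm), ho]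
        simp only [this]
        rw [prod_update_update hj']
        simp
      · refine (Finset.sum_le_card_nsmul _ _ _ fun p hp => ?_).trans
          (le_of_eq (by rw [hcard2, nsmul_eq_mul]; rfl))
        obtain ⟨h1, h2, h3⟩ := Finset.mem_offDiag.1 hp
        have h1' : p.1 ≠ o := by simpa [hS] using h1
        have h2' : p.2 ≠ o := by simpa [hS] using h2
        refine (slice_le θ _ (hg₂m p)).trans (le_of_eq ?_)
        have : ∀ i, l2norm (g₂ p i) = Function.update (Function.update (Function.update
            (fun _ => l2norm h) o (l2norm u)) p.1 (l2norm u)) p.2 (l2norm u) i := by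
          intro i
          simp only [hg₂, hg, tested, Function.apply_update (fun _ => l2norm), ho]
        simp only [this]
        rw [prod_update_update_update h1' h2' (Ne.symm h3)]
        simp

lemma lintegral_slice_tested_le {s δ : ℝ} (hs : 3 ≤ s) (hδ : 3 ≤ δ * s)
    {u m h : ℝ → ℝ≥0∞} (hu : Measurable u) (hm : Measurable m)
    (hh : Measurable h) (hum : ∀ ξ, |ξ| ≤ s ^ 2 → u ξ = 0) (huh : ∀ ξ, s ^ 2 < |ξ| → h ξ = u ξ)
    (hmh : ∀ ξ, s < |ξ| → |ξ| ≤ s ^ 2 → h ξ = m ξ) :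
    ∫⁻ θ in Ioc 0 (2 * Real.pi), slice θ (tested u h) ≤
      ENNReal.ofReal (2 * Real.pi) * (5 * (l2norm m * (l2norm u * l2norm h ^ 4)) +
        20 * (l2norm u * (l2norm u * (l2norm u * l2norm h ^ 3)))) +
      volume.restrict (Ioc 0 (2 * Real.pi)) (smallAngles δ) * (l2norm u * l2norm h ^ 5) := by
  set A := 5 * (l2norm m * (l2norm u * l2norm h ^ 4)) +
    20 * (l2norm u * (l2norm u * (l2norm u * l2norm h ^ 3)))
  set B := l2norm u * l2norm h ^ 5
  have hpt : ∀ θ, slice θ (tested u h) ≤ A + (smallAngles δ).indicator (fun _ => B) θ := by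
    intro θ
    by_cases hθ : θ ∈ smallAngles δ
    · rw [indicator_of_mem hθ]
      exact (slice_tested_le hu hh θ).trans le_add_self
    · exact (slice_tested_le_of_notMem hs hδ hθ hu hm hh hum huh hmh).trans le_self_add
  refine (lintegral_mono hpt).trans (le_of_eq ?_)
  rw [lintegral_add_left measurable_const, lintegral_const,
    lintegral_indicator_const (measurableSet_smallAngles δ), Measure.restrict_apply_univ,
    Real.volume_Ioc, sub_zero, mul_comm A, mul_comm B]

/-! ### Testing the Euler-Lagrange equation -/

lemma measurable_hat (f : L2) : Measurable (hat f) :=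
  (Lp.stronglyMeasurable (𝓕 f : L2)).measurable.comp (measurable_id.div_const _)

/-- The modulus of the Fourier transform. -/
noncomputable def amplitude (f : L2) (ξ : ℝ) : ℝ≥0∞ := ‖hat f ξ‖ₑ

lemma measurable_amplitude (f : L2) : Measurable (amplitude f) := (measurable_hat f).enorm

lemma memLp_hat (f : L2) : MemLp (hat f) 2 := by
  have h := (Lp.memLp (𝓕 f : L2)).integrable_norm_pow (by norm_num)
  refine (memLp_two_iff_integrable_sq_norm (measurable_hat f).aestronglyMeasurable).2 ?_
  exact Integrable.comp_div (g := fun x => ‖(𝓕 f : L2) x‖ ^ 2) (by simpa using h)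
    (by positivity)

lemma l2norm_amplitude_ne_top (f : L2) : l2norm (amplitude f) ≠ ∞ := by
  have h := (memLp_hat f).eLpNorm_ne_top
  rw [eLpNorm_eq_lintegral_rpow_enorm_toReal (by norm_num) (by norm_num)] at h
  simpa [l2norm, amplitude] using h

lemma ae_comp_div {p : ℝ → Prop} (h : ∀ᵐ x, p x) {c : ℝ} (hc : c ≠ 0) :
    ∀ᵐ ξ : ℝ, p (ξ / c) := by
  have hq : Measure.QuasiMeasurePreserving (fun ξ : ℝ => ξ / c) := by
    refine ⟨by fun_prop, ?_⟩
    have := Real.map_volume_mul_right (a := c⁻¹) (by positivity)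
    simp only [div_eq_mul_inv]
    rw [this]
    exact Measure.smul_absolutelyContinuous
  exact hq.ae h

/-- Bounded real Fourier multipliers supply the test functions. The rescaling by `2π` passes between
the two normalizations of the transform and leaves the factor `1 / (2π)` in Plancherel's identity.
-/
lemma exists_hat_ae_eq_mul (f : L2) {φ : ℝ → ℝ} (hφ : Measurable φ) {C : ℝ}
    (hC : ∀ ξ, |φ ξ| ≤ C) :
    ∃ g : L2, (∀ᵐ ξ, hat g ξ = φ ξ * hat f ξ) ∧
      inner ℂ g f = ((1 / (2 * Real.pi) * ∫ ξ, φ ξ * ‖hat f ξ‖ ^ 2 : ℝ) : ℂ) := by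
  have hpi : (2 * Real.pi) ≠ 0 := by positivity
  set ψ : ℝ → ℂ := fun x => φ (x * (2 * Real.pi)) * (𝓕 f : L2) x with hψ
  have hm : Measurable fun x : ℝ => (φ (x * (2 * Real.pi)) : ℂ) := by fun_prop
  have hmem : MemLp ψ 2 := by
    refine (Lp.memLp (𝓕 f : L2)).of_le_mul (c := C)
      (hm.mul (Lp.stronglyMeasurable (𝓕 f : L2)).measurable).aestronglyMeasurable
      (Eventually.of_forall fun x => ?_)
    rw [norm_mul, Complex.norm_real]
    exact mul_le_mul_of_nonneg_right (hC _) (norm_nonneg _)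
  set G : L2 := hmem.toLp ψ with hG
  have hGψ : ∀ᵐ x, G x = ψ x := hmem.coeFn_toLp
  have hFG : (𝓕 (𝓕⁻ G : L2) : L2) = G := FourierTransform.fourier_fourierInv_eq G
  refine ⟨𝓕⁻ G, ?_, ?_⟩
  · filter_upwards [ae_comp_div hGψ hpi] with ξ hξ
    rw [hat, hFG, hξ]
    simp only [hψ, hat, div_mul_cancel₀ _ hpi]
  · rw [← Lp.inner_fourier_eq, hFG, L2.inner_def]
    have e1 : ∫ x, inner ℂ (G x) ((𝓕 f : L2) x) =
        ∫ x, ((φ (x * (2 * Real.pi)) * ‖(𝓕 f : L2) x‖ ^ 2 : ℝ) : ℂ) := by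
      refine integral_congr_ae ?_
      filter_upwards [hGψ] with x hx
      rw [hx, hψ, RCLike.inner_apply, map_mul, Complex.conj_ofReal, mul_left_comm,
        Complex.mul_conj, Complex.normSq_eq_norm_sq]
      push_cast
      ring
    rw [e1, integral_complex_ofReal]
    congr 1
    have := Measure.integral_comp_div
      (fun x => φ (x * (2 * Real.pi)) * ‖(𝓕 f : L2) x‖ ^ 2) (2 * Real.pi)
    simp only [div_mul_cancel₀ _ hpi] at this
    simp only [hat]
    rw [this, abs_of_pos (by positivity), smul_eq_mul, ← mul_assoc, one_div, inv_mul_cancel₀ hpi,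
      one_mul]

lemma ae_coord {p : ℝ → Prop} (h : ∀ᵐ x, p x) (i : Fin 3) : ∀ᵐ v : R3, p (v i) :=
  (Measure.quasiMeasurePreserving_eval (fun _ : Fin 3 => (volume : Measure ℝ)) i).ae h

/-- The Euler-Lagrange equation tested with `g`, where `ĝ = φ f̂`. -/
lemma SolvesEulerLagrange.lintegral_le {ω : ℝ} (hω : 0 < ω) {f : L2}
    (hf : SolvesEulerLagrange ω f) {φ : ℝ → ℝ} (hφ : Measurable φ) (hφ0 : ∀ ξ, 0 ≤ φ ξ) {C : ℝ}
    (hC : ∀ ξ, φ ξ ≤ C) :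
    ENNReal.ofReal (ω / (2 * Real.pi)) *
        ∫⁻ ξ, ENNReal.ofReal (φ ξ) * amplitude f ξ ^ 2 ≤
      ENNReal.ofReal (1 / (2 * Real.sqrt 3)) * ∫⁻ θ in Ioc 0 (2 * Real.pi),
        slice θ (tested (fun ξ => ENNReal.ofReal (φ ξ) * amplitude f ξ) (amplitude f)) := by
  obtain ⟨g, hg, hin⟩ := exists_hat_ae_eq_mul f hφ (C := C) fun ξ => by
    rw [abs_of_nonneg (hφ0 ξ)]; exact hC ξ
  have heq := hf g
  have hint0 : 0 ≤ ∫ ξ, φ ξ * ‖hat f ξ‖ ^ 2 :=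
    integral_nonneg fun ξ => mul_nonneg (hφ0 ξ) (by positivity)
  have hI : Integrable fun ξ => φ ξ * ‖hat f ξ‖ ^ 2 := by
    have := (memLp_hat f).integrable_norm_pow (by norm_num)
    refine Integrable.bdd_mul (c := C) (by simpa using this) hφ.aestronglyMeasurable
      (Eventually.of_forall fun ξ => ?_)
    rw [Real.norm_eq_abs, abs_of_nonneg (hφ0 ξ)]
    exact hC ξ
  have hlhs : ENNReal.ofReal (ω / (2 * Real.pi)) *
      ∫⁻ ξ, ENNReal.ofReal (φ ξ) * amplitude f ξ ^ 2 = ‖(ω : ℂ) * inner ℂ g f‖ₑ := by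
    have e : ∀ ξ, ENNReal.ofReal (φ ξ) * amplitude f ξ ^ 2 =
        ENNReal.ofReal (φ ξ * ‖hat f ξ‖ ^ 2) := by
      intro ξ
      rw [amplitude, ENNReal.ofReal_mul (hφ0 ξ), ← ofReal_norm, ENNReal.ofReal_pow (norm_nonneg _)]
    simp only [e]
    rw [← ofReal_integral_eq_lintegral_ofReal hI
      (Eventually.of_forall fun ξ => mul_nonneg (hφ0 ξ) (by positivity)),
      ← ENNReal.ofReal_mul (by positivity), hin, ← Complex.ofReal_mul, ← ofReal_norm,
      Complex.norm_real, Real.norm_of_nonneg (by positivity)]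
    congr 1
    ring
  rw [hlhs, heq, Q]
  refine (enorm_integral_le_lintegral_enorm _).trans ?_
  have hm : ∀ (k : L2) (i : Fin 3), Measurable fun p : R3 × R3 => hat k (p.1 i) := fun k i =>
    (measurable_hat k).comp (by fun_prop)
  have hm' : ∀ (k : L2) (i : Fin 3), Measurable fun p : R3 × R3 => hat k (p.2 i) := fun k i =>
    (measurable_hat k).comp (by fun_prop)
  have hmc : ∀ (k : L2) (i : Fin 3), Measurable fun p : R3 × R3 => conj (hat k (p.1 i)) :=
    fun k i => Complex.continuous_conj.measurable.comp (hm k i)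
  have hM : Measurable fun p : R3 × R3 =>
      ‖conj (hat g (p.1 0)) * conj (hat f (p.1 1)) * conj (hat f (p.1 2)) *
        hat f (p.2 0) * hat f (p.2 1) * hat f (p.2 2)‖ₑ :=
    ((((((hmc g 0).mul (hmc f 1)).mul (hmc f 2)).mul (hm' f 0)).mul (hm' f 1)).mul
      (hm' f 2)).enorm
  -- Tonelli puts the angle outermost, so that the inner integral is a `slice`.
  have hsymm := lintegral_prod_symm' (μ := (volume : Measure R3))
    (ν := volume.restrict (Ioc 0 (2 * Real.pi))) _ (hM.comp continuous_rot.measurable)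
  simp only [Function.comp_def] at hsymm
  rw [deltaMeasure, lintegral_smul_measure, lintegral_map hM continuous_rot.measurable, hsymm,
    smul_eq_mul]
  refine mul_le_mul_right (lintegral_mono fun θ => ?_) _
  refine lintegral_mono_ae ?_
  -- The formula for `ĝ` holds only almost everywhere. Null sets of `ℝ` pull back to null sets under
  -- a coordinate of `R3`, and `ĝ` is evaluated only at `v 0`.
  filter_upwards [ae_coord hg 0] with v hv
  refine le_of_eq ?_
  simp only [Fintype.prod_sum_type, Fin.prod_univ_three, Sum.elim_inl, Sum.elim_inr, tested, hv,
    enorm_mul, RCLike.enorm_conj]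
  have hφe : ‖(φ (v 0) : ℂ)‖ₑ = ENNReal.ofReal (φ (v 0)) := by
    rw [← ofReal_norm, Complex.norm_real, Real.norm_of_nonneg (hφ0 _)]
  simp [Function.update_of_ne, hφe, amplitude, mul_assoc]

/-! ### Truncated Gaussian weights -/

/-- The weight `exp (min (μ ξ²) n)`. -/
noncomputable def weight (μ : ℝ) (n : ℕ) (ξ : ℝ) : ℝ := Real.exp (min (μ * ξ ^ 2) n)

lemma measurable_weight (μ : ℝ) (n : ℕ) : Measurable (weight μ n) := by
  unfold weight
  fun_prop

lemma weight_pos (μ : ℝ) (n : ℕ) (ξ : ℝ) : 0 < weight μ n ξ := Real.exp_pos _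

lemma weight_le (μ : ℝ) (n : ℕ) (ξ : ℝ) : weight μ n ξ ≤ Real.exp n :=
  Real.exp_le_exp.2 (min_le_right _ _)

/-- Subadditivity is what lets the truncated exponent inherit the inequality between the squares of
the frequencies. -/
lemma min_add_le {a b : ℝ} (ha : 0 ≤ a) (hb : 0 ≤ b) {n : ℝ} (hn : 0 ≤ n) :
    min (a + b) n ≤ min a n + min b n := by
  rcases le_total a n with h | h <;> rcases le_total b n with h' | h' <;>
    simp only [min_eq_left, min_eq_right, h, h'] <;>
    first
    | exact min_le_left _ _
    | exact (min_le_right _ _).trans (by linarith)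

/-- On the support of the two delta functions, the weight at one frequency is at most the product
of the weights at the others. -/
lemma weight_le_mul {μ : ℝ} (hμ : 0 ≤ μ) (n : ℕ) (θ : ℝ) (v : R3) :
    weight μ n (v 0) ≤ weight μ n (v 1) * weight μ n (v 2) *
      (weight μ n (rot θ v 0) * weight μ n (rot θ v 1) * weight μ n (rot θ v 2)) := by
  have hn : (0 : ℝ) ≤ n := n.cast_nonneg
  have hq : ∀ x : ℝ, 0 ≤ μ * x ^ 2 := fun x => by positivity
  simp only [weight, ← Real.exp_add]
  refine Real.exp_le_exp.2 ?_
  -- Conservation of the sum of squares gives this even without the terms in `v 1` and `v 2`. They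
  -- are kept so that every slot receives a weight.
  have h0 : μ * v 0 ^ 2 ≤ (μ * v 1 ^ 2 + μ * v 2 ^ 2) +
      (μ * rot θ v 0 ^ 2 + μ * rot θ v 1 ^ 2 + μ * rot θ v 2 ^ 2) := by
    have := rot_sq θ v
    nlinarith [hq (v 1), hq (v 2)]
  refine (min_le_min_right _ h0).trans ?_
  refine (min_add_le (add_nonneg (hq _) (hq _))
    (add_nonneg (add_nonneg (hq _) (hq _)) (hq _)) hn).trans ?_
  refine add_le_add (min_add_le (hq _) (hq _) hn) ?_
  refine (min_add_le (add_nonneg (hq _) (hq _)) (hq _) hn).trans ?_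
  exact add_le_add_left (min_add_le (hq _) (hq _) hn) _

/-- The weighted modulus of the Fourier transform. -/
noncomputable def weighted (f : L2) (μ : ℝ) (n : ℕ) (ξ : ℝ) : ℝ≥0∞ :=
  ENNReal.ofReal (weight μ n ξ) * amplitude f ξ

lemma measurable_weighted (f : L2) (μ : ℝ) (n : ℕ) : Measurable (weighted f μ n) :=
  (measurable_weight μ n).ennreal_ofReal.mul (measurable_amplitude f)

/-- The multiplier is the squared weight cut off to `U`. One weight stays in the first slot, and
`weight_le_mul` distributes the other over the remaining five. -/
lemma SolvesEulerLagrange.l2norm_indicator_sq_le {ω : ℝ} (hω : 0 < ω) {f : L2}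
    (hf : SolvesEulerLagrange ω f) {μ : ℝ} (hμ : 0 ≤ μ) (n : ℕ) {U : Set ℝ}
    (hU : MeasurableSet U) :
    ENNReal.ofReal (ω / (2 * Real.pi)) * l2norm (U.indicator (weighted f μ n)) ^ 2 ≤
      ENNReal.ofReal (1 / (2 * Real.sqrt 3)) * ∫⁻ θ in Ioc 0 (2 * Real.pi),
        slice θ (tested (U.indicator (weighted f μ n)) (weighted f μ n)) := by
  set φ : ℝ → ℝ := U.indicator fun ξ => weight μ n ξ ^ 2 with hφ
  have h := hf.lintegral_le hω (φ := φ) (((measurable_weight μ n).pow_const 2).indicator hU)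
    (fun ξ => indicator_nonneg (fun _ _ => by positivity) _) (C := Real.exp n ^ 2) (fun ξ => by
      refine (indicator_le_self' (fun _ _ => by positivity) ξ).trans ?_
      exact pow_le_pow_left₀ (weight_pos _ _ _).le (weight_le _ _ _) 2)
  refine le_trans (le_of_eq ?_) (h.trans (mul_le_mul_right (lintegral_mono fun θ =>
    lintegral_mono fun v => ?_) _))
  · rw [l2norm_sq]
    congr 1
    refine lintegral_congr fun ξ => ?_
    by_cases hξ : ξ ∈ U
    · simp only [hφ, indicator_of_mem hξ, weighted]
      rw [ENNReal.ofReal_pow (weight_pos _ _ _).le, mul_pow]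
    · simp [hφ, indicator_of_notMem hξ]
  · simp only [Fintype.prod_sum_type, Fin.prod_univ_three, Sum.elim_inl, Sum.elim_inr, tested]
    by_cases hv : v 0 ∈ U
    · simp only [Function.update_self, ne_eq, reduceCtorEq, not_false_eq_true,
        Function.update_of_ne, Sum.inl.injEq, one_ne_zero, Fin.reduceEq, hφ, indicator_of_mem hv,
        weighted]
      have hw := ENNReal.ofReal_le_ofReal (weight_le_mul hμ n θ v)
      have hp := fun x => (weight_pos μ n x).le
      rw [ENNReal.ofReal_mul (mul_nonneg (hp _) (hp _)), ENNReal.ofReal_mul (hp _),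
        ENNReal.ofReal_mul (mul_nonneg (hp _) (hp _)), ENNReal.ofReal_mul (hp _)] at hw
      rw [ENNReal.ofReal_pow (hp _)]
      calc _ = ENNReal.ofReal (weight μ n (v 0)) * (ENNReal.ofReal (weight μ n (v 0)) *
              (amplitude f (v 0) * amplitude f (v 1) * amplitude f (v 2) *
              (amplitude f (rot θ v 0) * amplitude f (rot θ v 1) * amplitude f (rot θ v 2)))) := by
            ring
        _ ≤ _ := mul_le_mul_left hw _
        _ = _ := by ring
    · simp [hφ, indicator_of_notMem hv]

/-! ### The bootstrap in the truncation parameter -/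

lemma exists_l2norm_tail_le {a : ℝ → ℝ≥0∞} (ha : Measurable a) (hfin : l2norm a ≠ ∞)
    {ε : ℝ≥0∞} (hε : 0 < ε) :
    ∃ N : ℕ, ∀ n ≥ N, l2norm ({ξ : ℝ | (n : ℝ) < |ξ|}.indicator a) ≤ ε := by
  have hset : ∀ n : ℕ, MeasurableSet {ξ : ℝ | (n : ℝ) < |ξ|} := fun n =>
    measurableSet_lt measurable_const (by fun_prop)
  have hlim : Tendsto (fun n : ℕ => ∫⁻ ξ, {ξ : ℝ | (n : ℝ) < |ξ|}.indicator a ξ ^ 2) atTop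
      (𝓝 (∫⁻ _ : ℝ, 0)) := by
    refine tendsto_lintegral_of_dominated_convergence (fun ξ => a ξ ^ 2)
      (fun n => (ha.indicator (hset n)).pow_const 2)
      (fun n => Eventually.of_forall fun ξ => pow_le_pow_left' (indicator_le_self _ _ ξ) 2)
      (by rw [← l2norm_sq]; exact ENNReal.pow_ne_top hfin)
      (Eventually.of_forall fun ξ => ?_)
    refine tendsto_const_nhds.congr' ?_
    obtain ⟨N, hN⟩ := exists_nat_ge |ξ|
    filter_upwards [eventually_ge_atTop N] with n hn
    rw [indicator_of_notMem, zero_pow two_ne_zero]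
    simp only [mem_ofPred_eq, not_lt]
    exact hN.trans (by exact_mod_cast hn)
  have hlim' : Tendsto (fun n : ℕ => l2norm ({ξ : ℝ | (n : ℝ) < |ξ|}.indicator a)) atTop (𝓝 0) := by
    rw [lintegral_zero] at hlim
    have := hlim.ennrpow_const (1 / 2)
    rwa [ENNReal.zero_rpow_of_pos (by norm_num)] at this
  exact eventually_atTop.1 (hlim'.eventually_le_const hε)

/-- This is the reason for the choice `μ = 1 / s ^ 4`: below the cutoff `s²` the weight costs only a
constant, independent of `n` and `s`. -/
lemma weight_le_exp_one {s : ℝ} (hs : 0 < s) (n : ℕ) {ξ : ℝ} (hξ : |ξ| ≤ s ^ 2) :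
    weight (1 / s ^ 4) n ξ ≤ Real.exp 1 := by
  refine Real.exp_le_exp.2 ((min_le_left _ _).trans ?_)
  have : ξ ^ 2 ≤ s ^ 4 := by
    rw [← sq_abs, show s ^ 4 = (s ^ 2) ^ 2 by ring]
    exact pow_le_pow_left₀ (abs_nonneg _) hξ 2
  rw [one_div, inv_mul_le_iff₀ (by positivity)]
  linarith

lemma weight_zero {μ : ℝ} (hμ : 0 ≤ μ) (ξ : ℝ) : weight μ 0 ξ = 1 := by
  rw [weight, Nat.cast_zero, min_eq_right (by positivity), Real.exp_zero]

/-- Raising the truncation by one multiplies norms by at most `e`. This bounded jump plays the role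
of continuity in the bootstrap. -/
lemma weight_succ_le (μ : ℝ) (n : ℕ) (ξ : ℝ) :
    weight μ (n + 1) ξ ≤ Real.exp 1 * weight μ n ξ := by
  rw [weight, weight, ← Real.exp_add]
  refine Real.exp_le_exp.2 ?_
  rw [← min_add_add_left]
  refine min_le_min (by linarith) ?_
  push_cast
  linarith

/-- The frequencies above `r`. -/
def highFreq (r : ℝ) : Set ℝ := {ξ | r < |ξ|}

lemma measurableSet_highFreq (r : ℝ) : MeasurableSet (highFreq r) :=
  measurableSet_lt measurable_const (by fun_prop)

lemma weighted_le (f : L2) (μ : ℝ) (n : ℕ) (ξ : ℝ) :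
    weighted f μ n ξ ≤ ENNReal.ofReal (Real.exp n) * amplitude f ξ :=
  mul_le_mul_left (ENNReal.ofReal_le_ofReal (weight_le μ n ξ)) _

lemma l2norm_weighted_le (f : L2) {s : ℝ} (hs : 0 < s) (n : ℕ) :
    l2norm (weighted f (1 / s ^ 4) n) ≤ ENNReal.ofReal (Real.exp 1) * l2norm (amplitude f) +
      l2norm ((highFreq (s ^ 2)).indicator (weighted f (1 / s ^ 4) n)) := by
  rw [← l2norm_const_mul _ ENNReal.ofReal_ne_top]
  refine (l2norm_mono fun ξ => ?_).trans (l2norm_add_le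
    (measurable_const.mul (measurable_amplitude f))
    ((measurable_weighted f _ n).indicator (measurableSet_highFreq _)))
  by_cases hξ : ξ ∈ highFreq (s ^ 2)
  · rw [indicator_of_mem hξ]
    exact le_add_self
  · refine le_trans ?_ le_self_add
    exact mul_le_mul_left (ENNReal.ofReal_le_ofReal (weight_le_exp_one hs n (not_lt.1 hξ))) _

lemma l2norm_mid_le (f : L2) {s : ℝ} (hs : 0 < s) (n : ℕ) :
    l2norm ((highFreq s \ highFreq (s ^ 2)).indicator (weighted f (1 / s ^ 4) n)) ≤
      ENNReal.ofReal (Real.exp 1) * l2norm ((highFreq s).indicator (amplitude f)) := by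
  rw [← l2norm_const_mul _ ENNReal.ofReal_ne_top]
  refine l2norm_mono fun ξ => ?_
  by_cases hξ : ξ ∈ highFreq s \ highFreq (s ^ 2)
  · rw [indicator_of_mem hξ, indicator_of_mem hξ.1]
    exact mul_le_mul_left (ENNReal.ofReal_le_ofReal (weight_le_exp_one hs n (not_lt.1 hξ.2))) _
  · rw [indicator_of_notMem hξ]
    exact zero_le

/-- A priori finiteness, the purpose of the truncation: it permits passing to real numbers and
cancelling a factor of the norm. -/
lemma l2norm_high_ne_top (f : L2) (μ : ℝ) (n : ℕ) (U : Set ℝ) :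
    l2norm (U.indicator (weighted f μ n)) ≠ ∞ := by
  refine ne_top_of_le_ne_top (ENNReal.mul_ne_top (ENNReal.ofReal_ne_top (r := Real.exp n))
    (l2norm_amplitude_ne_top f)) ?_
  rw [← l2norm_const_mul _ ENNReal.ofReal_ne_top]
  exact l2norm_mono fun ξ => (indicator_le_self _ _ ξ).trans (weighted_le f μ n ξ)

/-- The inequality for the norm of the weighted high frequency part. -/
lemma SolvesEulerLagrange.high_le {ω : ℝ} (hω : 0 < ω) {f : L2} (hf : SolvesEulerLagrange ω f)
    {s δ H T β : ℝ} (hs : 3 ≤ s) (hδ : 3 ≤ δ * s) (n : ℕ) (hT0 : 0 ≤ T) (hβ0 : 0 ≤ β)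
    (hH : Real.exp 1 * (l2norm (amplitude f)).toReal + 1 ≤ H)
    (hT : l2norm ((highFreq s).indicator (amplitude f)) ≤ ENNReal.ofReal T)
    (hβ : volume.restrict (Ioc 0 (2 * Real.pi)) (smallAngles δ) ≤ ENNReal.ofReal β)
    {ν : ℝ} (hν : (l2norm ((highFreq (s ^ 2)).indicator (weighted f (1 / s ^ 4) n))).toReal = ν)
    (hν1 : ν ≤ 1) :
    ω / (2 * Real.pi) * ν ≤ 35 * (Real.exp 1 * T) * H ^ 4 + 140 * ν ^ 2 * H ^ 3 + β * H ^ 5 := by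
  have hs0 : 0 < s := by linarith
  have hA := l2norm_amplitude_ne_top f
  set A := (l2norm (amplitude f)).toReal with hAdef
  have hA0 : 0 ≤ A := ENNReal.toReal_nonneg
  have hH0 : 0 ≤ H := by
    have := Real.exp_pos 1
    nlinarith
  set h := weighted f (1 / s ^ 4) n with hh
  set u := (highFreq (s ^ 2)).indicator h with hu
  set m := (highFreq s \ highFreq (s ^ 2)).indicator h with hm
  have hhm : Measurable h := measurable_weighted f _ n
  have hfin : l2norm u ≠ ∞ := l2norm_high_ne_top f _ n _
  have hνe : l2norm u = ENNReal.ofReal ν := by rw [← hν, ENNReal.ofReal_toReal hfin]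
  have hν0 : 0 ≤ ν := hν ▸ ENNReal.toReal_nonneg
  have hhH : l2norm h ≤ ENNReal.ofReal H := by
    refine (l2norm_weighted_le f hs0 n).trans ?_
    rw [← hh, ← hu, hνe, ← ENNReal.ofReal_toReal hA, ← ENNReal.ofReal_mul (by positivity),
      ← ENNReal.ofReal_add (by positivity) hν0]
    exact ENNReal.ofReal_le_ofReal (by linarith)
  have hmT : l2norm m ≤ ENNReal.ofReal (Real.exp 1 * T) := by
    refine (l2norm_mid_le f hs0 n).trans ?_
    rw [ENNReal.ofReal_mul (by positivity)]
    exact mul_le_mul_right hT _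
  have key := (hf.l2norm_indicator_sq_le hω (μ := 1 / s ^ 4) (by positivity) n
    (measurableSet_highFreq (s ^ 2))).trans (mul_le_mul_right
      (lintegral_slice_tested_le hs hδ (u := u) (m := m) (h := h)
        (hhm.indicator (measurableSet_highFreq _))
        (hhm.indicator ((measurableSet_highFreq _).diff (measurableSet_highFreq _))) hhm
        (fun ξ hξ => indicator_of_notMem (s := highFreq (s ^ 2)) (not_lt.2 hξ) _)
        (fun ξ hξ => (indicator_of_mem (s := highFreq (s ^ 2)) hξ _).symm)
        (fun ξ h1 h2 => (indicator_of_mem (s := highFreq s \ highFreq (s ^ 2))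
          ⟨h1, not_lt.2 h2⟩ _).symm)) _)
  rw [← hh, ← hu, hνe] at key
  set E := Real.exp 1 * T with hE
  have hE0 : 0 ≤ E := by positivity
  have key2 : ENNReal.ofReal (ω / (2 * Real.pi)) * ENNReal.ofReal ν ^ 2 ≤
      ENNReal.ofReal (1 / (2 * Real.sqrt 3)) * (ENNReal.ofReal (2 * Real.pi) *
        (ENNReal.ofReal 5 * (ENNReal.ofReal E * (ENNReal.ofReal ν * ENNReal.ofReal H ^ 4)) +
        ENNReal.ofReal 20 * (ENNReal.ofReal ν * (ENNReal.ofReal ν *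
          (ENNReal.ofReal ν * ENNReal.ofReal H ^ 3)))) +
        ENNReal.ofReal β * (ENNReal.ofReal ν * ENNReal.ofReal H ^ 5)) := by
    refine key.trans ?_
    have e5 : ENNReal.ofReal 5 = 5 := by norm_num
    have e20 : ENNReal.ofReal 20 = 20 := by norm_num
    rw [e5, e20]
    gcongr
  have hpi := Real.pi_pos
  rw [← ENNReal.ofReal_pow hν0, ← ENNReal.ofReal_pow hH0, ← ENNReal.ofReal_pow hH0,
    ← ENNReal.ofReal_pow hH0] at key2
  repeat rw [← ENNReal.ofReal_mul (by positivity)] at key2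
  rw [← ENNReal.ofReal_add (by positivity) (by positivity),
    ← ENNReal.ofReal_mul (by positivity), ← ENNReal.ofReal_add (by positivity) (by positivity),
    ← ENNReal.ofReal_mul (by positivity), ENNReal.ofReal_le_ofReal_iff (by positivity)] at key2
  set X := 5 * (E * (ν * H ^ 4)) + 20 * (ν * (ν * (ν * H ^ 3))) with hX
  have hX0 : 0 ≤ X := by positivity
  have hc1 : 1 / (2 * Real.sqrt 3) ≤ 1 := by
    rw [div_le_one (by positivity)]
    have : 1 ≤ Real.sqrt 3 := Real.one_le_sqrt.2 (by norm_num)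
    linarith
  -- The constants `35 = 7 · 5` and `140 = 7 · 20` come from this bound, the prefactor `1 / (2√3)`
  -- being replaced by `1`.
  have h7 : 2 * Real.pi ≤ 7 := by linarith [Real.pi_lt_d2]
  have key3 : ω / (2 * Real.pi) * ν ^ 2 ≤ 7 * X + β * (ν * H ^ 5) := by
    refine key2.trans ((mul_le_of_le_one_left (by positivity) hc1).trans ?_)
    exact add_le_add_left (mul_le_mul_of_nonneg_right h7 hX0) _
  rcases hν0.eq_or_lt with h0 | hpos
  · rw [← h0]
    rw [mul_zero]
    positivity
  · refine le_of_mul_le_mul_right (le_trans (le_of_eq ?_) (key3.trans (le_of_eq ?_))) hpos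
    · ring
    · rw [hX]; ring

/-- The weighted modulus of the Fourier transform is square integrable, uniformly in the
truncation. -/
lemma SolvesEulerLagrange.exists_l2norm_weighted_le {ω : ℝ} (hω : 0 < ω) {f : L2}
    (hf : SolvesEulerLagrange ω f) :
    ∃ μ > 0, ∃ C : ℝ≥0∞, C ≠ ∞ ∧ ∀ n, l2norm (weighted f μ n) ≤ C := by
  set H := Real.exp 1 * (l2norm (amplitude f)).toReal + 1 with hH
  have he := Real.exp_pos 1
  have hA0 : 0 ≤ (l2norm (amplitude f)).toReal := ENNReal.toReal_nonneg
  have hH0 : 0 < H := by positivity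
  set κ := ω / (2 * Real.pi) with hκ
  have hκ0 : 0 < κ := by have := Real.pi_pos; positivity
  -- The bound `1/3` ensures `3η ≤ 1`, as `high_le` requires. The other bound makes the quadratic
  -- term at most `κ ν / 2` whenever `ν ≤ 3η`. With `β` and `T` below, the two remaining terms are
  -- at most `κ η / 4` each.
  set η := min (1 / 3) (κ / (840 * H ^ 3)) with hη
  have hη0 : 0 < η := by positivity
  have hη1 : 3 * η ≤ 1 := by linarith [min_le_left (1 / 3) (κ / (840 * H ^ 3))]
  have hη2 : 420 * η * H ^ 3 ≤ κ / 2 := by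
    have := min_le_right (1 / 3) (κ / (840 * H ^ 3))
    rw [← hη, le_div_iff₀ (by positivity)] at this
    linarith
  set β := κ * η / (4 * H ^ 5) with hβ
  have hβ0 : 0 < β := by positivity
  obtain ⟨δ, hδ0, hδ⟩ := exists_smallAngles_measure_le (ENNReal.ofReal_pos.2 hβ0)
  set T := min η (κ * η / (140 * Real.exp 1 * H ^ 4)) with hT
  have hT0 : 0 < T := by positivity
  obtain ⟨N, hN⟩ := exists_l2norm_tail_le (measurable_amplitude f) (l2norm_amplitude_ne_top f)
    (ENNReal.ofReal_pos.2 hT0)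
  obtain ⟨k, hk⟩ := exists_nat_ge (max 3 (3 / δ))
  -- A single scale for the tail bound, `3 ≤ s` and `3 ≤ δ s`. It is fixed before `n`, so `μ = 1 / s
  -- ^ 4` is independent of the truncation.
  set s : ℝ := ((max N k : ℕ) : ℝ) with hs
  have hks : (k : ℝ) ≤ s := Nat.cast_le.2 (le_max_right N k)
  have hs3 : 3 ≤ s := (le_max_left _ _).trans (hk.trans hks)
  have hs0 : 0 < s := by linarith
  have hsδ : 3 ≤ δ * s := by
    have := (le_max_right _ _).trans (hk.trans hks)
    rw [div_le_iff₀ hδ0] at this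
    linarith
  have htail : l2norm ((highFreq s).indicator (amplitude f)) ≤ ENNReal.ofReal T :=
    hN _ (le_max_left N k)
  have hfin := fun n => l2norm_high_ne_top f (1 / s ^ 4) n (highFreq (s ^ 2))
  have hstep : ∀ n, (l2norm ((highFreq (s ^ 2)).indicator (weighted f (1 / s ^ 4) n))).toReal ≤ η := by
    intro n
    induction n with
    | zero =>
      refine ENNReal.toReal_le_of_le_ofReal hη0.le (le_trans (l2norm_mono fun ξ => ?_)
        (htail.trans (ENNReal.ofReal_le_ofReal (min_le_left _ _))))
      have hsub : highFreq (s ^ 2) ⊆ highFreq s := fun ξ (hξ : s ^ 2 < |ξ|) =>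
        lt_of_le_of_lt (by nlinarith) hξ
      have e : weighted f (1 / s ^ 4) 0 = amplitude f := by
        ext ξ
        rw [weighted, weight_zero (by positivity), ENNReal.ofReal_one, one_mul]
      rw [e]
      exact indicator_le_indicator_of_subset hsub (fun _ => zero_le) ξ
    | succ n ih =>
      set ν := (l2norm ((highFreq (s ^ 2)).indicator (weighted f (1 / s ^ 4) (n + 1)))).toReal with hν
      have hν0 : 0 ≤ ν := ENNReal.toReal_nonneg
      have h3 : ν ≤ 3 * η := by
        have h1 : l2norm ((highFreq (s ^ 2)).indicator (weighted f (1 / s ^ 4) (n + 1))) ≤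
            ENNReal.ofReal (Real.exp 1) *
              l2norm ((highFreq (s ^ 2)).indicator (weighted f (1 / s ^ 4) n)) := by
          rw [← l2norm_const_mul _ ENNReal.ofReal_ne_top]
          refine l2norm_mono fun ξ => ?_
          by_cases hξ : ξ ∈ highFreq (s ^ 2)
          · simp only [indicator_of_mem hξ, weighted]
            rw [← mul_assoc, ← ENNReal.ofReal_mul he.le]
            exact mul_le_mul_left (ENNReal.ofReal_le_ofReal (weight_succ_le _ n ξ)) _
          · rw [indicator_of_notMem hξ]
            exact zero_le
        have h2 := ENNReal.toReal_mono (ENNReal.mul_ne_top ENNReal.ofReal_ne_top (hfin n)) h1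
        rw [ENNReal.toReal_mul, ENNReal.toReal_ofReal he.le] at h2
        have : Real.exp 1 ≤ 3 := by linarith [Real.exp_one_lt_d9]
        calc ν ≤ _ := h2
          _ ≤ 3 * η := mul_le_mul this ih ENNReal.toReal_nonneg (by norm_num)
      have hmain := hf.high_le hω hs3 hsδ (n + 1) hT0.le hβ0.le hH.ge htail hδ hν.symm
        (h3.trans hη1)
      have t1 : 35 * (Real.exp 1 * T) * H ^ 4 ≤ κ * η / 4 := by
        have := min_le_right η (κ * η / (140 * Real.exp 1 * H ^ 4))
        rw [← hT, le_div_iff₀ (by positivity)] at this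
        linarith
      have t2 : 140 * ν ^ 2 * H ^ 3 ≤ κ / 2 * ν := by
        calc 140 * ν ^ 2 * H ^ 3 = 140 * ν * H ^ 3 * ν := by ring
          _ ≤ 140 * (3 * η) * H ^ 3 * ν := by gcongr
          _ = 420 * η * H ^ 3 * ν := by ring
          _ ≤ κ / 2 * ν := by gcongr
      have t3 : β * H ^ 5 = κ * η / 4 := by
        rw [hβ]; field_simp
      -- From `κ ν ≤ κ η / 4 + κ ν / 2 + κ η / 4`, absorbing the middle term improves `ν ≤ 3η` to `ν
      -- ≤ η`.
      have : κ * ν ≤ κ * η := by linarith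
      exact le_of_mul_le_mul_left this hκ0
  refine ⟨1 / s ^ 4, by positivity, ENNReal.ofReal (Real.exp 1) * l2norm (amplitude f) +
    ENNReal.ofReal η, ENNReal.add_ne_top.2 ⟨ENNReal.mul_ne_top ENNReal.ofReal_ne_top
      (l2norm_amplitude_ne_top f), ENNReal.ofReal_ne_top⟩, fun n => ?_⟩
  refine (l2norm_weighted_le f hs0 n).trans (add_le_add_right ?_ _)
  rw [← ENNReal.ofReal_toReal (hfin n)]
  exact ENNReal.ofReal_le_ofReal (hstep n)

/-- Gaussian decay of the Fourier transform. -/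
lemma SolvesEulerLagrange.exists_memLp_exp_mul_hat {ω : ℝ} (hω : 0 < ω) {f : L2}
    (hf : SolvesEulerLagrange ω f) :
    ∃ μ : ℝ, 0 < μ ∧
      MemLp (fun ξ : ℝ => (Real.exp (μ * |ξ| ^ 2) : ℂ) * hat f ξ) 2 volume := by
  obtain ⟨μ, hμ, C, hC, hle⟩ := hf.exists_l2norm_weighted_le hω
  have hmeas : Measurable fun ξ : ℝ => (Real.exp (μ * |ξ| ^ 2) : ℂ) * hat f ξ := by
    have := measurable_hat f
    fun_prop
  refine ⟨μ, hμ, hmeas.aestronglyMeasurable, ?_⟩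
  have hlim : ∀ ξ, Tendsto (fun n => weighted f μ n ξ ^ 2) atTop
      (𝓝 (‖(Real.exp (μ * |ξ| ^ 2) : ℂ) * hat f ξ‖ₑ ^ 2)) := by
    intro ξ
    -- At a fixed `ξ` the truncation is inactive once `n ≥ μ ξ²`, so the sequence is eventually
    -- constant and Fatou's lemma applies.
    refine tendsto_const_nhds.congr' ?_
    obtain ⟨N, hN⟩ := exists_nat_ge (μ * ξ ^ 2)
    filter_upwards [eventually_ge_atTop N] with n hn
    have : (N : ℝ) ≤ n := by exact_mod_cast hn
    rw [weighted, weight, min_eq_left (hN.trans this), enorm_mul, ← ofReal_norm (_ : ℂ),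
      Complex.norm_real, Real.norm_of_nonneg (Real.exp_pos _).le, sq_abs, amplitude]
  have hint : ∫⁻ ξ, ‖(Real.exp (μ * |ξ| ^ 2) : ℂ) * hat f ξ‖ₑ ^ 2 ≤ C ^ 2 := by
    calc _ = ∫⁻ ξ, liminf (fun n => weighted f μ n ξ ^ 2) atTop :=
          lintegral_congr fun ξ => (hlim ξ).liminf_eq.symm
      _ ≤ liminf (fun n => ∫⁻ ξ, weighted f μ n ξ ^ 2) atTop :=
          lintegral_liminf_le fun n => (measurable_weighted f μ n).pow_const 2
      _ ≤ C ^ 2 := by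
          refine liminf_le_of_le (by isBoundedDefault) fun b hb => ?_
          obtain ⟨n, hn⟩ := hb.exists
          refine hn.trans ?_
          rw [← l2norm_sq]
          exact pow_le_pow_left' (hle n) 2
  rw [eLpNorm_lt_top_iff_lintegral_rpow_enorm_lt_top (by norm_num) (by norm_num)]
  simpa using lt_of_le_of_lt hint (ENNReal.pow_lt_top hC.lt_top)

/-! ### The entire extension -/

lemma memLp_exp_mul_exp_neg {μ : ℝ} (hμ : 0 < μ) (b : ℝ) :
    MemLp (fun x : ℝ => Real.exp (b * |x|) * Real.exp (-μ * x ^ 2)) 2 := by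
  have hm : Measurable fun x : ℝ => Real.exp (b * |x|) * Real.exp (-μ * x ^ 2) := by fun_prop
  refine (memLp_two_iff_integrable_sq hm.aestronglyMeasurable).2 ?_
  have hg := (integrable_exp_neg_mul_sq hμ).const_mul (Real.exp (b ^ 2 / μ))
  refine hg.mono' (hm.pow_const 2).aestronglyMeasurable (Eventually.of_forall fun x => ?_)
  rw [Real.norm_of_nonneg (by positivity), ← Real.exp_add, ← Real.exp_add, ← Real.exp_nat_mul]
  refine Real.exp_le_exp.2 ?_
  -- Completing the square bounds `2b|x| - 2μx²` by `b²/μ - μx²`, so half of the Gaussian decay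
  -- absorbs the exponential.
  have h1 : b ^ 2 / μ + μ * x ^ 2 - 2 * (b * |x|) = (b - μ * |x|) ^ 2 / μ := by
    rw [← sq_abs x]
    field_simp
    ring
  have h2 : 0 ≤ (b - μ * |x|) ^ 2 / μ := by positivity
  push_cast
  linarith

/-- A function with Gaussian decay in `L²` is integrable against every exponential. -/
lemma integrable_exp_mul_norm {G : ℝ → ℂ} {μ : ℝ} (hμ : 0 < μ)
    (hG : MemLp (fun x : ℝ => (Real.exp (μ * x ^ 2) : ℂ) * G x) 2) (b : ℝ) :
    Integrable fun x : ℝ => Real.exp (b * |x|) * ‖G x‖ := by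
  -- Hölder's inequality with both exponents `2`: the two Gaussian factors cancel in the product.
  have h := (memLp_exp_mul_exp_neg hμ b).integrable_mul hG.norm
  refine h.congr (Eventually.of_forall fun x => ?_)
  simp only [Pi.mul_apply, norm_mul, Complex.norm_real, Real.norm_of_nonneg (Real.exp_pos _).le]
  rw [mul_assoc, ← mul_assoc (Real.exp (-μ * x ^ 2)), ← Real.exp_add]
  simp

/-- The Fourier-Laplace transform. -/
noncomputable def fourierLaplace (G : ℝ → ℂ) (z : ℂ) : ℂ :=
  ∫ x : ℝ, Complex.exp (2 * Real.pi * Complex.I * x * z) * G x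

lemma norm_exp_two_pi_I_mul_le (x : ℝ) (z : ℂ) :
    ‖Complex.exp (2 * Real.pi * Complex.I * x * z)‖ ≤ Real.exp (2 * Real.pi * ‖z‖ * |x|) := by
  refine (Complex.norm_exp_le_exp_norm _).trans (le_of_eq ?_)
  congr 1
  simp only [norm_mul, Complex.norm_I, Complex.norm_real, RCLike.norm_ofNat, Real.norm_eq_abs,
    abs_of_pos Real.pi_pos]
  ring

/-- Differentiation under the integral on the unit ball about `z₀`, where the kernel is at most `exp
(b |x|)`. The factor `|x|` produced by the derivative is absorbed by `exp |x|`, hence the exponent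
`b + 1` in the dominating function. -/
lemma differentiable_fourierLaplace {G : ℝ → ℂ} (hGm : AEStronglyMeasurable G)
    (hG : ∀ b : ℝ, Integrable fun x : ℝ => Real.exp (b * |x|) * ‖G x‖) :
    Differentiable ℂ (fourierLaplace G) := by
  intro z₀
  set b : ℝ := 2 * Real.pi * (‖z₀‖ + 1) with hb
  have hpi := Real.pi_pos
  have hm : ∀ z : ℂ, AEStronglyMeasurable
      fun x : ℝ => Complex.exp (2 * Real.pi * Complex.I * x * z) * G x := fun z =>
    (by fun_prop : Continuous fun x : ℝ =>
      Complex.exp (2 * Real.pi * Complex.I * x * z)).aestronglyMeasurable.mul hGm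
  have hexp : ∀ (x : ℝ) (z : ℂ), ‖z‖ ≤ ‖z₀‖ + 1 →
      ‖Complex.exp (2 * Real.pi * Complex.I * x * z)‖ ≤ Real.exp (b * |x|) := fun x z hz =>
    (norm_exp_two_pi_I_mul_le x z).trans (Real.exp_le_exp.2 (by rw [hb]; gcongr))
  refine (hasDerivAt_integral_of_dominated_loc_of_deriv_le (μ := volume)
    (F := fun z (x : ℝ) => Complex.exp (2 * Real.pi * Complex.I * x * z) * G x)
    (F' := fun z (x : ℝ) => Complex.exp (2 * Real.pi * Complex.I * x * z) *
      (2 * Real.pi * Complex.I * x) * G x)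
    (bound := fun x => 2 * Real.pi * (Real.exp ((b + 1) * |x|) * ‖G x‖))
    (Metric.ball_mem_nhds z₀ one_pos) (Eventually.of_forall hm) ?_ ?_ ?_ ?_ ?_).2.differentiableAt
  · refine (hG b).mono' (hm z₀) (Eventually.of_forall fun x => ?_)
    rw [norm_mul]
    exact mul_le_mul_of_nonneg_right (hexp x z₀ (by linarith)) (norm_nonneg _)
  · exact (by fun_prop : Continuous fun x : ℝ => Complex.exp (2 * Real.pi * Complex.I * x * z₀) *
      (2 * Real.pi * Complex.I * x)).aestronglyMeasurable.mul hGm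
  · refine Eventually.of_forall fun x z hz => ?_
    have hz' : ‖z‖ ≤ ‖z₀‖ + 1 := by
      have h1 := norm_sub_norm_le z z₀
      rw [mem_ball_iff_norm] at hz
      linarith
    have h2 : ‖(2 * Real.pi * Complex.I * x : ℂ)‖ = 2 * Real.pi * |x| := by
      simp only [norm_mul, Complex.norm_I, Complex.norm_real, RCLike.norm_ofNat, Real.norm_eq_abs,
        abs_of_pos hpi]
      ring
    have h3 : |x| ≤ Real.exp |x| := (by linarith : |x| ≤ |x| + 1).trans (Real.add_one_le_exp _)
    rw [norm_mul, norm_mul, h2, add_mul, one_mul, Real.exp_add]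
    calc _ ≤ Real.exp (b * |x|) * (2 * Real.pi * Real.exp |x|) * ‖G x‖ := by
          gcongr
          exact hexp x z hz'
      _ = _ := by ring
  · exact (hG (b + 1)).const_mul _
  · refine Eventually.of_forall fun x z _ => ?_
    have h1 : HasDerivAt (fun z : ℂ => 2 * Real.pi * Complex.I * x * z)
        (2 * Real.pi * Complex.I * x) z := by
      simpa using (hasDerivAt_id z).const_mul (2 * Real.pi * Complex.I * x : ℂ)
    exact h1.cexp.mul_const _

/-! ### Pointwise Fourier inversion when the transform is integrable. -/

lemma fourierInv_eq_fourierLaplace (G : ℝ → ℂ) (x : ℝ) : 𝓕⁻ G x = fourierLaplace G x := by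
  rw [Real.fourierInv_eq', fourierLaplace]
  refine integral_congr_ae (Eventually.of_forall fun y => ?_)
  simp only [RCLike.inner_apply, conj_trivial, smul_eq_mul]
  congr 2
  push_cast
  ring

lemma integral_fourierInv_mul {φ G : ℝ → ℂ} (hφ : Integrable φ) (hG : Integrable G) :
    ∫ ξ, 𝓕⁻ φ ξ * G ξ = ∫ x, φ x * 𝓕⁻ G x := by
  -- The inverse transform is the Fourier integral for the pairing `-innerₗ ℝ`. This pairing is
  -- symmetric, so flipping it changes nothing.
  have h := VectorFourier.integral_fourierIntegral_smul_eq_flip (μ := volume) (ν := volume)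
    (e := Real.fourierChar) (L := -innerₗ ℝ) Real.continuous_fourierChar
    (by simp; fun_prop) hφ hG
  have hflip : (-innerₗ ℝ : ℝ →ₗ[ℝ] ℝ →ₗ[ℝ] ℝ).flip = -innerₗ ℝ := by
    ext; simp
  rw [hflip] at h
  simpa [Real.fourierInv_eq, VectorFourier.fourierIntegral] using h

/-- The inverse Fourier transform on `L²` is given by the integral for integrable functions. -/
lemma ae_eq_fourierInv (f : L2) (hG : Integrable (𝓕 f : L2)) :
    ∀ᵐ x, f x = 𝓕⁻ ((𝓕 f : L2) : ℝ → ℂ) x := by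
  set G : L2 := 𝓕 f with hGdef
  have hf : 𝓕⁻ G = f := FourierTransform.fourierInv_fourier_eq f
  have hcont : Continuous (𝓕⁻ (G : ℝ → ℂ)) := by
    have e : 𝓕⁻ (G : ℝ → ℂ) = VectorFourier.fourierIntegral Real.fourierChar volume
        (-innerₗ ℝ) (G : ℝ → ℂ) := by
      ext x
      simp [Real.fourierInv_eq, VectorFourier.fourierIntegral]
    rw [e]
    exact VectorFourier.fourierIntegral_continuous Real.continuous_fourierChar
      (by simp; fun_prop) hG
  -- Both sides are locally integrable, so equality against smooth compactly supported functions
  -- suffices. There the distributional inverse transform of `G` agrees with the integral one by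
  -- `integral_fourierInv_mul`.
  refine ae_eq_of_integral_contDiff_smul_eq
    ((Lp.memLp f).locallyIntegrable (by norm_num)) hcont.locallyIntegrable fun g hg hgs => ?_
  set φ : 𝓢(ℝ, ℂ) := HasCompactSupport.toSchwartzMap (f := fun x => (g x : ℂ))
    (hgs.comp_left Complex.ofReal_zero) (Complex.ofRealCLM.contDiff.comp hg) with hφ
  have hφg : ∀ x, φ x = g x := fun x => rfl
  have h := congrArg (fun T : 𝓢'(ℝ, ℂ) => T φ) (Lp.fourierInv_toTemperedDistribution_eq G)
  simp only [TemperedDistribution.fourierInv_apply, Lp.toTemperedDistribution_apply, hf] at h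
  have h2 := integral_fourierInv_mul φ.integrable hG
  simp only [SchwartzMap.fourierInv_coe, smul_eq_mul] at h
  rw [h2] at h
  simpa only [hφg, Complex.real_smul] using h.symm

lemma exists_analytic_extension {f : L2} {μ : ℝ} (hμ : 0 < μ)
    (h : MemLp (fun ξ : ℝ => (Real.exp (μ * |ξ| ^ 2) : ℂ) * hat f ξ) 2 volume) :
    ∃ F : ℂ → ℂ, AnalyticOnNhd ℂ F Set.univ ∧ ∀ᵐ x : ℝ, F (x : ℂ) = f x := by
  set G : ℝ → ℂ := ((𝓕 f : L2) : ℝ → ℂ) with hG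
  have hGm : AEStronglyMeasurable G := (Lp.stronglyMeasurable (𝓕 f : L2)).aestronglyMeasurable
  have hpi : 2 * Real.pi ≠ 0 := by positivity
  -- Substituting `ξ = 2πx` passes from `hat f` to `𝓕 f` and multiplies the Gaussian rate by
  -- `(2π)²`.
  have hG2 : MemLp (fun x : ℝ => (Real.exp (μ * (2 * Real.pi) ^ 2 * x ^ 2) : ℂ) * G x) 2 := by
    have hm : AEStronglyMeasurable
        fun x : ℝ => (Real.exp (μ * (2 * Real.pi) ^ 2 * x ^ 2) : ℂ) * G x :=
      (by fun_prop : Continuous fun x : ℝ =>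
        (Real.exp (μ * (2 * Real.pi) ^ 2 * x ^ 2) : ℂ)).aestronglyMeasurable.mul hGm
    refine (memLp_two_iff_integrable_sq_norm hm).2 ?_
    have h2 := ((memLp_two_iff_integrable_sq_norm h.1).1 h).comp_mul_right' hpi
    refine h2.congr (Eventually.of_forall fun x => ?_)
    simp only [hat, hG, mul_div_cancel_right₀ _ hpi, sq_abs]
    ring_nf
  have hint := integrable_exp_mul_norm (by positivity) hG2
  have hG1 : Integrable G := by
    refine (integrable_norm_iff hGm).1 ?_
    simpa using hint 0
  refine ⟨fourierLaplace G, ?_, ?_⟩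
  · exact (differentiable_fourierLaplace hGm hint).differentiableOn.analyticOnNhd isOpen_univ
  · filter_upwards [ae_eq_fourierInv f hG1] with x hx
    rw [hx, fourierInv_eq_fourierLaplace]

end Strichartz

theorem theorem1 (ω : ℝ) (hω : 0 < ω) (f : Strichartz.L2)
    (hf : Strichartz.SolvesEulerLagrange ω f) :
    (∃ μ : ℝ, 0 < μ ∧
      MemLp (fun ξ : ℝ => (Real.exp (μ * |ξ| ^ 2) : ℂ) * Strichartz.hat f ξ) 2 volume) ∧
    (∃ F : ℂ → ℂ, AnalyticOnNhd ℂ F Set.univ ∧ ∀ᵐ x : ℝ, F (x : ℂ) = f x) := by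
  obtain ⟨μ, hμ, h⟩ := hf.exists_memLp_exp_mul_hat hω
  exact ⟨⟨μ, hμ, h⟩, Strichartz.exists_analytic_extension hμ h⟩
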